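/- **Theorem 1.1 (Normality).** Setting. An interval exchange with $d$ labelled bands consists of a thickened interval with $d$ bands attached to it: its combinatorial type $\pi$ records the labels of the band ends along the top and along the bottom, from left to right, each label occurring exactly twice; a band is orientation reversing if both its ends are on the same side. The widths $\lambda=(\lambda_\alpha)$ satisfy the switch condition that the widths of the band ends have the same sum on the top and on the bottom. Collapsing the interval and the bands gives a train track with one switch. The type is *non-classical* if there is at least one orientation reversing band on each side and the track is complete, i.e. each boundary component of the oriented band surface (a complementary region of the track, once discs or once-punctured discs are glued in) has exactly three cusps (an ideal triangle) or exactly one cusp (a once-punctured monogon), the cusps being the gaps between consecutive band ends on the same side. Rauzy induction (a split) compares the bands $\alpha_1$, $\alpha_0$ in the rightmost positions on the top and on the bottom. If $\lambda_{\alpha_1}>\lambda_{\alpha_0}$, then $\lambda_{\alpha_1}$ is replaced by $\lambda_{\alpha_1}-\lambda_{\alpha_0}$, and the rightmost bottom end of $\alpha_0$ is moved next to the other end of $\alpha_1$: to its right on the bottom if $\alpha_1$ preserves orientation, to its left on the top if $\alpha_1$ reverses it. If $\lambda_{\alpha_1}<\lambda_{\alpha_0}$ the roles of top and bottom are exchanged;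 if the two widths are equal the split is undefined. Iterating gives the expansion of $(\pi,\lambda)$. The reduced Rauzy diagram $G$ has as vertices the non-classical types with $d$ bands up to relabelling, and as arrows the splits realized by some non-classical interval exchange with positive widths, each recorded with the side whose rightmost band is the wider one. A vertex is non-transient, i.e. lies in a sink, if it can be reached by a directed path from every vertex that it reaches; its sink is the set of vertices that it reaches. The configuration space of $\pi$ is $W_\pi=\{x\in\mathbb R^d : x_\alpha\ge 0,\ \sum_\alpha x_\alpha=1,\ x \text{ satisfies the switch condition of } \pi\}$, with its normalized $(d-2)$-dimensional Lebesgue measure. Statement. Let $\pi$ be the type of a labelled non-classical interval exchange with $d$ bands. Then for almost every $x\in W_\pi$ the expansion of $(\pi,x)$ is normal: if some stage of the expansion is a vertex of a sink $G_0$ of $G$, then every finite sequence of one or more consecutive splits in $G_0$ occurs infinitely often in the expansion. In particular, if $\pi$ lies in a sink $G_0$, then for almost every $x\in W_\pi$ every finite sequence of one or more consecutive splits in $G_0$ occurs infinitely often in the expansion of $(\pi,x)$. -/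

import Mathlib

open MeasureTheory

namespace NonclassicalIET

/-- The two sides of the thickened interval. -/
inductive Side where
  | top
  | bot

/-- Exchange combinatorics with bands labelled by `Fin d`: the labels of the band ends met along the
top and along the bottom of the thickened interval, read from left to right. -/
@[ext]
structure Combinatorics (d : ℕ) where
  top : List (Fin d)
  bot : List (Fin d)

namespace Combinatorics

variable {d : ℕ}

/-- The word of labels along a given side. -/
def word (π : Combinatorics d) : Side → List (Fin d)
  | .top => π.top
  | .bot => π.bot

/-- Every label is carried by exactly one band, i.e. it labels exactly two band ends. -/
def IsLabelled (π : Combinatorics d) : Prop :=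
  ∀ α : Fin d, π.top.count α + π.bot.count α = 2

/-- The band `α` is orientation reversing and has both of its ends on the side `s`. -/
def IsReversing (π : Combinatorics d) (s : Side) (α : Fin d) : Prop :=
  (π.word s).count α = 2

/-! ### Complementary regions of the associated train track

A *gap* `(s, k)` is the place on the side `s` between the `(k-1)`-st and the `k`-th band end
(counted from `0`), with `0 ≤ k ≤ (π.word s).length`. The extreme gaps lie at the two endpoints of the
interval, where the boundary passes smoothly from top to bottom; all other gaps are cusps.
Walking along the edges of the bands joins gaps to gaps, and the resulting classes of gaps are the
boundary components of the oriented band surface, i.e. the complementary regions. -/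

/-- Two gaps that are joined by one edge of a band or by an endpoint of the interval. An orientation
preserving band joins left edge to left edge and right edge to right edge; an orientation reversing
band joins the left edge of either end to the right edge of the other end. -/
inductive GapAdj (π : Combinatorics d) : Side × ℕ → Side × ℕ → Prop
  | leftEndpoint : GapAdj π (.top, 0) (.bot, 0)
  | rightEndpoint : GapAdj π (.top, π.top.length) (.bot, π.bot.length)
  | preservingLeft (i j : ℕ) (α : Fin d) (hi : π.top[i]? = some α) (hj : π.bot[j]? = some α) :
      GapAdj π (.top, i) (.bot, j)
  | preservingRight (i j : ℕ) (α : Fin d) (hi : π.top[i]? = some α) (hj : π.bot[j]? = some α) :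
      GapAdj π (.top, i + 1) (.bot, j + 1)
  | reversing (s : Side) (i j : ℕ) (α : Fin d) (hij : i ≠ j)
      (hi : (π.word s)[i]? = some α) (hj : (π.word s)[j]? = some α) :
      GapAdj π (s, i) (s, j + 1)

/-- The gap is a cusp of the train track. -/
def IsCusp (π : Combinatorics d) (g : Side × ℕ) : Prop :=
  0 < g.2 ∧ g.2 < (π.word g.1).length

/-- The cusps of the complementary region that contains the gap `g`. -/
def regionCusps (π : Combinatorics d) (g : Side × ℕ) : Set (Side × ℕ) :=
  {h | Relation.EqvGen π.GapAdj g h ∧ π.IsCusp h}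

/-- Completeness: the train track embeds in an oriented surface so that every complementary region is
an ideal triangle (three cusps) or a once punctured monogon (one cusp). -/
def IsComplete (π : Combinatorics d) : Prop :=
  ∀ (s : Side) (k : ℕ), k ≤ (π.word s).length →
    (π.regionCusps (s, k)).ncard = 3 ∨ (π.regionCusps (s, k)).ncard = 1

/-- Combinatorial types of labelled non-classical interval exchanges: recurrent, with orientation
reversing bands (so at least one on each side), and complete. -/
structure IsNonclassical (π : Combinatorics d) : Prop where
  labelled : π.IsLabelled
  reversing : ∀ s : Side, ∃ α : Fin d, π.IsReversing s α
  complete : π.IsComplete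

/-! ### Rauzy induction on combinatorial types -/

/-- Exchange top and bottom. -/
def swap (π : Combinatorics d) : Combinatorics d := ⟨π.bot, π.top⟩

/-- The split in which the critical band `a` on the top is wider than the critical band `c` on the
bottom. The critical end of `c` is carried along `a` and lands next to the other end of `a`: to its
right on the bottom if `a` preserves orientation, to its left on the top if `a` reverses it. -/
def splitTop (π : Combinatorics d) : Combinatorics d :=
  match π.top.getLast?, π.bot.getLast? with
  | some a, some c =>
      { top := π.top.dropLast.flatMap (fun x => if x = a then [c, x] else [x]) ++ [a]
        bot := π.bot.dropLast.flatMap (fun x => if x = a then [x, c] else [x]) }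
  | _, _ => π

/-- The result of the split in which the critical band on the side `s` is the wider one. -/
def split (π : Combinatorics d) : Side → Combinatorics d
  | .top => π.splitTop
  | .bot => π.swap.splitTop.swap

/-- Change the labelling of the bands. -/
def relabel (σ : Equiv.Perm (Fin d)) (π : Combinatorics d) : Combinatorics d :=
  ⟨π.top.map σ, π.bot.map σ⟩

/-- Two labelled types are equivalent when they differ only by the labelling. -/
instance setoid (d : ℕ) : Setoid (Combinatorics d) where
  r π π' := ∃ σ : Equiv.Perm (Fin d), π.relabel σ = π'
  iseqv :=
    { refl := fun π => ⟨1, by ext1 <;> simp [relabel]⟩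
      symm := by
        rintro π _ ⟨σ, rfl⟩
        exact ⟨σ⁻¹, by ext1 <;> simp [relabel, Function.comp_def]⟩
      trans := by
        rintro π _ _ ⟨σ, rfl⟩ ⟨τ, rfl⟩
        exact ⟨τ * σ, by ext1 <;> simp [relabel, Function.comp_def]⟩ }

/-! ### Widths and configuration spaces -/

/-- The switch condition: the widths of the band ends have the same sum on the top and on the bottom.
-/
def Switch (π : Combinatorics d) (lam : Fin d → ℝ) : Prop :=
  (π.top.map lam).sum = (π.bot.map lam).sum

/-- The configuration space of a type: the normalized widths, a subset of the standard simplex. -/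
def configurationSpace (π : Combinatorics d) : Set (EuclideanSpace ℝ (Fin d)) :=
  {x | (∀ α, 0 ≤ x α) ∧ ∑ α, x α = 1 ∧ π.Switch (fun α => x α)}

/-- Lebesgue measure on the configuration space: the `(d - 2)`-dimensional Euclidean volume, divided
by the total volume of the configuration space. -/
noncomputable def lebesgue (π : Combinatorics d) : Measure (EuclideanSpace ℝ (Fin d)) :=
  (μHE[d - 2] π.configurationSpace)⁻¹ • (μHE[d - 2]).restrict π.configurationSpace

end Combinatorics

/-- A combinatorial type without labelling. -/
abbrev ReducedType (d : ℕ) : Type := Quotient (Combinatorics.setoid d)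

/-- A labelled interval exchange: exchange combinatorics together with (unnormalized) widths. -/
structure Exchange (d : ℕ) where
  comb : Combinatorics d
  width : Fin d → ℝ

namespace Exchange

variable {d : ℕ}

/-- The combinatorial type of an exchange, without labelling. -/
def type (T : Exchange d) : ReducedType d := ⟦T.comb⟧

/-- One step of Rauzy induction, with the side of the wider critical band. It is undefined when the
two critical bands have equal width. -/
noncomputable def step (T : Exchange d) : Option (Side × Exchange d) :=
  match T.comb.top.getLast?, T.comb.bot.getLast? with
  | some a, some c =>
      if T.width c < T.width a then
        some (.top, ⟨T.comb.split .top, Function.update T.width a (T.width a - T.width c)⟩)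
      else if T.width a < T.width c then
        some (.bot, ⟨T.comb.split .bot, Function.update T.width c (T.width c - T.width a)⟩)
      else none
  | _, _ => none

/-- The `n`-th stage of the expansion by iterated Rauzy induction, if the induction gets that far. -/
noncomputable def stage (T : Exchange d) : ℕ → Option (Exchange d)
  | 0 => some T
  | n + 1 => (T.stage n).bind fun T' => T'.step.map Prod.snd

/-- A non-classical interval exchange with positive widths. -/
structure IsNonclassical (T : Exchange d) : Prop where
  comb : T.comb.IsNonclassical
  pos : ∀ α, 0 < T.width α
  switch : T.comb.Switch T.width

end Exchange

/-! ### The reduced Rauzy diagram -/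

section Diagram

variable {d : ℕ}

/-- The arrow of the reduced Rauzy diagram from `p` to `q` in which the critical band on the side `s`
is the wider one. -/
def Arrow (s : Side) (p q : ReducedType d) : Prop :=
  ∃ T T' : Exchange d, T.IsNonclassical ∧ T.type = p ∧ T.step = some (s, T') ∧ T'.type = q

/-- There is a directed path from `p` to `q` in the reduced Rauzy diagram. -/
def Reaches : ReducedType d → ReducedType d → Prop :=
  Relation.ReflTransGen fun p q => ∃ s, Arrow s p q

/-- The vertex `p` lies in a sink: every vertex to which `p` splits down splits back down to `p`. The
sink of `p` is then the set of vertices that `p` reaches. -/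
def NonTransient (p : ReducedType d) : Prop :=
  ∀ q, Reaches p q → Reaches q p

/-- A sequence of splits, listed with their endpoints, is a directed path starting from `p`. -/
def IsSplittingSequence : ReducedType d → List (Side × ReducedType d) → Prop
  | _, [] => True
  | p, (s, q) :: j => Arrow s p q ∧ IsSplittingSequence q j

/-- The expansion of `T` begins with the given sequence of splits starting from `p`. -/
def BeginsWith : Exchange d → ReducedType d → List (Side × ReducedType d) → Prop
  | T, p, [] => T.type = p
  | T, p, (s, q) :: j => T.type = p ∧ ∃ T', T.step = some (s, T') ∧ BeginsWith T' q j

/-- The given sequence of splits starting from `p` occurs infinitely often in the expansion of `T`. -/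
def OccursInfinitelyOften (T : Exchange d) (p : ReducedType d) (j : List (Side × ReducedType d)) :
    Prop :=
  ∃ᶠ n in Filter.atTop, ∃ T', T.stage n = some T' ∧ BeginsWith T' p j

end Diagram

end NonclassicalIET

/-! A split acts on widths by `x_a ↦ x_a - x_c`. The dual action `l_c ↦ l_c + l_a` on positive
weights preserves `∑ l_i x_i`, so the wedge of positive widths with `∑ l_i x_i ≤ 1` is cut by the
first comparison, up to a null set, into two wedges for the new weights (`subWidth_mem_wedge_iff`).
All wedges are measured by one Haar measure, in a parametrization of the switch solutions that is
transported along the splits. Ratios of masses are thus the conditional probabilities of splits.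

Two distortion estimates come from explicit multiples of transvections: a loser whose weight is
comparable to the largest weight `M` does lose with definite probability (`mass_split_ge`), and a
width is rarely much smaller than `1 / M` (`mass_narrow_le`). Both need short vectors in the cone of
widths (`exists_ray`). Labels that are never critical, collected in `D`, have uncontrolled weights
and must be kept out of these vectors; this is possible because the switch condition involves only
labels of `D` or only labels outside `D`.

Call the weights balanced when all labels outside `D` have weights comparable to `M`. From balanced
weights any prescribed finite path of splits is followed with definite probability. Balance is
reached by induction on the number of light labels. Losers are heavy as long as no light label is
critical, so a path can be followed until one is. Then, with probability at least one half, all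
widths outside `D` are of order `1 / M`, and a potential argument (`mem_hitsIn_of_light_crit`)
forces some light label to become heavy while all weights stay controlled.

The probabilities are used as a contraction. If a split-invariant family of sets has proportion at
most `u` in every wedge, and at balanced states over the vertex `p` the bound improves to `(1 - ε)
u`, then it improves by some factor in every wedge, so the proportion is zero (`mass_eq_zero`). This
applies to the widths whose expansion avoids a given path from `p`, since balanced widths over `p`
follow that path with definite probability.

A sink gives the required recurrence for labelled types, because a relabelling has finite order.
Infinite occurrence follows from a single occurrence at almost every later stage, by a countable
union of null sets; homogeneity, Fubini and a Lipschitz chart carry the null set over to the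
configuration space. -/

namespace NonclassicalIET

/-- The opposite side. -/
def Side.opp : Side → Side
  | .top => .bot
  | .bot => .top

@[simp] theorem Side.opp_opp (s : Side) : s.opp.opp = s := by cases s <;> rfl

theorem Side.eq_or_eq_opp (s t : Side) : t = s ∨ t = s.opp := by cases s <;> cases t <;> simp [opp]

/-! ### Splits on widths and the dual action on weights. -/

/-- The operation `x_a ← x_a - x_c` on widths. -/
def subWidth {d : ℕ} (a c : Fin d) : (Fin d → ℝ) →ₗ[ℝ] (Fin d → ℝ) :=
  LinearMap.id - (LinearMap.proj c : (Fin d → ℝ) →ₗ[ℝ] ℝ).smulRight (Pi.single a 1)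

theorem subWidth_apply {d : ℕ} (a c : Fin d) (x : Fin d → ℝ) (i : Fin d) :
    subWidth a c x i = if i = a then x a - x c else x i := by
  by_cases h : i = a
  · subst h; simp [subWidth]
  · simp [subWidth, h]

theorem subWidth_eq_update {d : ℕ} (a c : Fin d) (x : Fin d → ℝ) :
    subWidth a c x = Function.update x a (x a - x c) := by
  ext i
  rw [subWidth_apply, Function.update_apply]

theorem subWidth_injective {d : ℕ} {a c : Fin d} (h : a ≠ c) :
    Function.Injective (subWidth a c) := by
  intro x y hxy
  have h1 : ∀ i, subWidth a c x i = subWidth a c y i := fun i => by rw [hxy]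
  have hc := h1 c
  simp only [subWidth_apply, h.symm, if_false] at hc
  ext i
  have hi := h1 i
  simp only [subWidth_apply] at hi
  split_ifs at hi with hia
  · subst hia; linarith
  · exact hi

/-- The dual operation on linear weights. -/
def addWeight {d : ℕ} (a c : Fin d) (l : Fin d → ℝ) : Fin d → ℝ :=
  Function.update l c (l c + l a)

theorem addWeight_apply {d : ℕ} (a c : Fin d) (l : Fin d → ℝ) (i : Fin d) :
    addWeight a c l i = if i = c then l c + l a else l i := by
  rw [addWeight, Function.update_apply]

theorem addWeight_pos {d : ℕ} (a c : Fin d) {l : Fin d → ℝ} (hl : ∀ i, 0 < l i) (i : Fin d) :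
    0 < addWeight a c l i := by
  rw [addWeight_apply]
  split_ifs
  · exact add_pos (hl _) (hl _)
  · exact hl i

theorem le_addWeight {d : ℕ} (a c : Fin d) {l : Fin d → ℝ} (hl : ∀ i, 0 < l i) (i : Fin d) :
    l i ≤ addWeight a c l i := by
  rw [addWeight_apply]
  split_ifs with h
  · subst h; linarith [hl a]
  · exact le_rfl

theorem sum_addWeight_mul_subWidth {d : ℕ} {a c : Fin d} (h : a ≠ c) (l x : Fin d → ℝ) :
    ∑ i, addWeight a c l i * subWidth a c x i = ∑ i, l i * x i := by
  have h1 : ∀ i, addWeight a c l i * subWidth a c x i =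
      l i * x i + ((if i = c then l a * x c else 0) - (if i = a then l a * x c else 0)) := by
    intro i
    rw [addWeight_apply, subWidth_apply]
    by_cases hc : i = c
    · subst hc; simp [h.symm]; ring
    · by_cases ha : i = a
      · subst ha; simp [hc]; ring
      · simp [ha, hc]
  simp_rw [h1, Finset.sum_add_distrib, Finset.sum_sub_distrib]
  simp

namespace Combinatorics

variable {d : ℕ}

/-! ### The switch condition and its coefficients under a split. -/

/-- The critical (rightmost) label on a side. -/
def crit (π : Combinatorics d) (s : Side) : Option (Fin d) := (π.word s).getLast?

theorem word_split_self (π : Combinatorics d) (s : Side) {a c : Fin d} (ha : π.crit s = some a)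
    (hc : π.crit s.opp = some c) :
    (π.split s).word s =
      (π.word s).dropLast.flatMap (fun x => if x = a then [c, x] else [x]) ++ [a] := by
  cases s <;> simp only [crit, word, Side.opp] at ha hc <;>
    simp [split, splitTop, word, swap, ha, hc]

theorem word_split_opp (π : Combinatorics d) (s : Side) {a c : Fin d} (ha : π.crit s = some a)
    (hc : π.crit s.opp = some c) :
    (π.split s).word s.opp =
      (π.word s.opp).dropLast.flatMap (fun x => if x = a then [x, c] else [x]) := by
  cases s <;> simp only [crit, word, Side.opp] at ha hc <;>
    simp [split, splitTop, word, swap, ha, hc, Side.opp]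

theorem crit_split_self (π : Combinatorics d) (s : Side) {a c : Fin d} (ha : π.crit s = some a)
    (hc : π.crit s.opp = some c) : (π.split s).crit s = some a := by
  rw [crit, word_split_self π s ha hc]
  simp

theorem word_eq_dropLast_append {π : Combinatorics d} {s : Side} {a : Fin d}
    (ha : π.crit s = some a) : π.word s = (π.word s).dropLast ++ [a] := by
  rw [crit] at ha
  exact (List.dropLast_append_getLast? a ha).symm

/-- The sum of the widths along the side `s` minus the sum along the other side. -/
def sw (π : Combinatorics d) (s : Side) : (Fin d → ℝ) →ₗ[ℝ] ℝ :=
  ((π.word s).map fun α => (LinearMap.proj α : (Fin d → ℝ) →ₗ[ℝ] ℝ)).sum -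
    ((π.word s.opp).map fun α => (LinearMap.proj α : (Fin d → ℝ) →ₗ[ℝ] ℝ)).sum

theorem sum_proj_apply (w : List (Fin d)) (x : Fin d → ℝ) :
    (w.map fun α => (LinearMap.proj α : (Fin d → ℝ) →ₗ[ℝ] ℝ)).sum x = (w.map x).sum := by
  induction w with
  | nil => simp
  | cons b w ih => simp [ih]

theorem sw_apply (π : Combinatorics d) (s : Side) (x : Fin d → ℝ) :
    π.sw s x = ((π.word s).map x).sum - ((π.word s.opp).map x).sum := by
  rw [sw, LinearMap.sub_apply, sum_proj_apply, sum_proj_apply]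

theorem switch_iff (π : Combinatorics d) (s : Side) (x : Fin d → ℝ) :
    π.Switch x ↔ π.sw s x = 0 := by
  rw [sw_apply, sub_eq_zero]
  cases s <;> simp [Switch, word, Side.opp, eq_comm]

theorem sum_flatMap_left (w : List (Fin d)) (a c : Fin d) (x : Fin d → ℝ) :
    ((w.flatMap (fun y => if y = a then [c, y] else [y])).map x).sum =
      (w.map x).sum + w.count a * x c := by
  induction w with
  | nil => simp
  | cons b w ih =>
    rw [List.flatMap_cons, List.map_append, List.sum_append, ih, List.count_cons]
    by_cases h : b = a
    · simp [h]; ring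
    · simp [h]; ring

theorem sum_flatMap_right (w : List (Fin d)) (a c : Fin d) (x : Fin d → ℝ) :
    ((w.flatMap (fun y => if y = a then [y, c] else [y])).map x).sum =
      (w.map x).sum + w.count a * x c := by
  induction w with
  | nil => simp
  | cons b w ih =>
    rw [List.flatMap_cons, List.map_append, List.sum_append, ih, List.count_cons]
    by_cases h : b = a
    · simp [h]; ring
    · simp [h]; ring

theorem sum_map_subWidth (w : List (Fin d)) (a c : Fin d) (x : Fin d → ℝ) :
    (w.map (subWidth a c x)).sum = (w.map x).sum - w.count a * x c := by
  induction w with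
  | nil => simp
  | cons b w ih =>
    rw [List.map_cons, List.sum_cons, ih, List.count_cons, subWidth_apply]
    by_cases h : b = a
    · simp [h]; ring
    · simp [h]; ring

/-- Each end of `a` other than the critical one is shortened by `x_c`, and an end of `c` is inserted
beside every such end; only the critical end of `a` is shortened without compensation, and this
matches the end of `c` removed from the opposite side. -/
theorem sw_split (π : Combinatorics d) (s : Side) {a c : Fin d} (ha : π.crit s = some a)
    (hc : π.crit s.opp = some c) (hac : a ≠ c) (x : Fin d → ℝ) :
    (π.split s).sw s (subWidth a c x) = π.sw s x := by
  have e1 := word_eq_dropLast_append ha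
  have e2 := word_eq_dropLast_append hc
  rw [sw_apply, sw_apply, word_split_self π s ha hc, word_split_opp π s ha hc]
  conv_rhs => rw [e1, e2]
  simp only [List.map_append, List.sum_append, sum_flatMap_left, sum_flatMap_right,
    sum_map_subWidth, subWidth_apply, List.map_cons, List.map_nil, List.sum_cons, List.sum_nil]
  simp [hac.symm]
  ring

/-- The coefficient of a width in the switch condition, seen from the side `s`. -/
def coef (π : Combinatorics d) (s : Side) (α : Fin d) : ℝ :=
  (π.word s).count α - (π.word s.opp).count α

theorem sw_single (π : Combinatorics d) (s : Side) (α : Fin d) (r : ℝ) :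
    π.sw s (Pi.single α r) = π.coef s α * r := by
  have h : ∀ w : List (Fin d), (w.map (Pi.single α r : Fin d → ℝ)).sum = w.count α * r := by
    intro w
    induction w with
    | nil => simp
    | cons b w ih =>
      rw [List.map_cons, List.sum_cons, ih, List.count_cons, Pi.single_apply]
      by_cases h : b = α
      · simp [h]; ring
      · simp [h]
  rw [sw_apply, h, h, coef]; ring

theorem sw_eq_sum (π : Combinatorics d) (s : Side) (x : Fin d → ℝ) :
    π.sw s x = ∑ α, π.coef s α * x α := by
  conv_lhs => rw [← Finset.univ_sum_single x, map_sum]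
  simp_rw [sw_single]

theorem coef_opp (π : Combinatorics d) (s : Side) (α : Fin d) : π.coef s.opp α = -π.coef s α := by
  simp [coef]

theorem coef_split (π : Combinatorics d) (s : Side) {a c : Fin d} (ha : π.crit s = some a)
    (hc : π.crit s.opp = some c) (hac : a ≠ c) (α : Fin d) :
    (π.split s).coef s α = π.coef s α + if α = c then π.coef s a else 0 := by
  -- The preimage of a basis vector under `subWidth`; evaluating `sw_split` on it reads off the new
  -- coefficient. Only the loser's coefficient can change.
  have key : subWidth a c (Pi.single α 1 + if α = c then Pi.single a 1 else 0) =
      Pi.single α (1 : ℝ) := by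
    ext i
    rw [subWidth_apply]
    by_cases h : α = c
    · subst h
      by_cases hi : i = a
      · subst hi; simp [hac]
      · simp [hi]
    · simp only [h, if_false, add_zero]
      by_cases hi : i = a
      · subst hi; simp [Pi.single_apply, Ne.symm h]
      · simp [hi]
  have h1 := sw_split π s ha hc hac (Pi.single α 1 + if α = c then Pi.single a 1 else 0)
  rw [key, sw_single, map_add, sw_single] at h1
  split_ifs at h1 ⊢ with h
  · rw [sw_single] at h1; linarith
  · simp only [map_zero] at h1; linarith

/-- On a labelled type the coefficients of the switch condition are `0` or `±2`. -/
theorem IsLabelled.coef_trichotomy {π : Combinatorics d} (h : π.IsLabelled) (s : Side)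
    (α : Fin d) : π.coef s α = 0 ∨ π.coef s α = 2 ∨ π.coef s α = -2 := by
  have h1 : (π.word s).count α + (π.word s.opp).count α = 2 := by
    have := h α
    cases s <;> simp only [word, Side.opp] <;> omega
  rw [coef]
  have h2 : (π.word s).count α ≤ 2 := by omega
  generalize (π.word s).count α = m at *
  generalize (π.word s.opp).count α = k at *
  interval_cases m
  · have : k = 2 := by omega
    subst this; norm_num
  · have : k = 1 := by omega
    subst this; norm_num
  · have : k = 0 := by omega
    subst this; norm_num

theorem IsLabelled.count_opp_eq_zero {π : Combinatorics d} (h : π.IsLabelled) {s : Side}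
    {α : Fin d} (hs : 0 < π.coef s α) : (π.word s.opp).count α = 0 := by
  have h1 : (π.word s).count α + (π.word s.opp).count α = 2 := by
    have := h α
    cases s <;> simp only [word, Side.opp] <;> omega
  rw [coef] at hs
  have h3 : ((π.word s.opp).count α : ℝ) < (π.word s).count α := by linarith
  have h4 : (π.word s.opp).count α < (π.word s).count α := by exact_mod_cast h3
  omega

/-- A critical label is nonnegatively weighted from its own side. -/
theorem IsLabelled.coef_crit_nonneg {π : Combinatorics d} (h : π.IsLabelled) {s : Side}
    {a : Fin d} (ha : π.crit s = some a) : 0 ≤ π.coef s a := by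
  have h1 : (π.word s).count a + (π.word s.opp).count a = 2 := by
    have := h a
    cases s <;> simp only [word, Side.opp] <;> omega
  have h2 : 0 < (π.word s).count a := by
    rw [List.count_pos_iff, word_eq_dropLast_append ha]; simp
  rw [coef, sub_nonneg]
  have h3 : (π.word s.opp).count a ≤ (π.word s).count a := by omega
  exact_mod_cast h3

end Combinatorics

namespace Exchange

variable {d : ℕ}

theorem step_eq_some_iff (T T' : Exchange d) (s : Side) :
    T.step = some (s, T') ↔ ∃ a c, T.comb.crit s = some a ∧ T.comb.crit s.opp = some c ∧
      T.width c < T.width a ∧ T' = ⟨T.comb.split s, subWidth a c T.width⟩ := by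
  rw [step]
  cases h1 : T.comb.top.getLast? with
  | none => cases s <;> simp [Combinatorics.crit, Combinatorics.word, Side.opp, h1]
  | some a =>
    cases h2 : T.comb.bot.getLast? with
    | none => cases s <;> simp [Combinatorics.crit, Combinatorics.word, Side.opp, h2]
    | some c =>
      simp only [subWidth_eq_update]
      rcases lt_trichotomy (T.width c) (T.width a) with h | h | h
      · cases s <;>
          simp [Combinatorics.crit, Combinatorics.word, Side.opp, h1, h2, h, h.not_gt,
            eq_comm]
      · cases s <;> simp [Combinatorics.crit, Combinatorics.word, Side.opp, h1, h2, h]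
      · cases s <;>
          simp [Combinatorics.crit, Combinatorics.word, Side.opp, h1, h2, h, h.not_gt,
            eq_comm]

theorem stage_succ_eq (T : Exchange d) (n : ℕ) :
    T.stage (n + 1) = T.step.bind fun q => q.2.stage n := by
  induction n with
  | zero =>
    simp only [stage, Option.bind_some]
    cases T.step <;> rfl
  | succ n ih =>
    rw [stage, ih]
    cases T.step <;> simp [stage]

end Exchange

end NonclassicalIET

namespace NonclassicalIET

/-! ### Masses of wedges and the two distortion estimates. -/

section Mass

set_option linter.unusedSectionVars false

variable {d : ℕ} {V : Type*} [NormedAddCommGroup V] [NormedSpace ℝ V]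

/-- The positive widths whose total weight is at most one. -/
def wedge (l : Fin d → ℝ) : Set (Fin d → ℝ) :=
  {x | (∀ i, 0 < x i) ∧ ∑ i, l i * x i ≤ 1}

/-- A linear parametrization of the space of solutions of the switch condition of `π`. -/
structure Parametrizes (φ : V →ₗ[ℝ] (Fin d → ℝ)) (π : Combinatorics d) : Prop where
  injective : Function.Injective φ
  mem_range : ∀ x, x ∈ Set.range φ ↔ π.Switch x

/-- The parameter space and its Haar measure stay fixed while the parametrization is composed with
the split, so no Jacobian enters when masses before and after a split are compared. -/
theorem Parametrizes.split {φ : V →ₗ[ℝ] (Fin d → ℝ)} {π : Combinatorics d}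
    (h : Parametrizes φ π) {s : Side} {a c : Fin d} (ha : π.crit s = some a)
    (hc : π.crit s.opp = some c) (hac : a ≠ c) :
    Parametrizes (subWidth a c ∘ₗ φ) (π.split s) where
  injective := (subWidth_injective hac).comp h.injective
  mem_range x := by
    have hx : subWidth a c (Function.update x a (x a + x c)) = x := by
      ext i
      rw [subWidth_apply]
      by_cases hi : i = a
      · subst hi; simp [hac.symm]
      · simp [hi]
    rw [Combinatorics.switch_iff _ s]
    constructor
    · rintro ⟨y, rfl⟩
      rw [LinearMap.comp_apply, Combinatorics.sw_split π s ha hc hac, ← Combinatorics.switch_iff]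
      exact (h.mem_range _).1 ⟨y, rfl⟩
    · intro h0
      rw [← hx, Combinatorics.sw_split π s ha hc hac, ← Combinatorics.switch_iff,
        ← h.mem_range] at h0
      obtain ⟨y, hy⟩ := h0
      exact ⟨y, by rw [LinearMap.comp_apply, hy, hx]⟩

/-- This is the Markov property of the process: conditioning a wedge on the outcome of a comparison
gives the wedge of the new weights. -/
theorem subWidth_mem_wedge_iff {a c : Fin d} (hac : a ≠ c) {l x : Fin d → ℝ} :
    subWidth a c x ∈ wedge (addWeight a c l) ↔ x ∈ wedge l ∧ x c < x a := by
  simp only [wedge, Set.mem_ofPred_eq, sum_addWeight_mul_subWidth hac]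
  constructor
  · rintro ⟨h1, h2⟩
    have h3 := h1 a
    have h4 := h1 c
    simp only [subWidth_apply, if_true, hac.symm, if_false] at h3 h4
    refine ⟨⟨fun i => ?_, h2⟩, by linarith⟩
    have h5 := h1 i
    rw [subWidth_apply] at h5
    split_ifs at h5 with hi
    · subst hi; linarith
    · exact h5
  · rintro ⟨⟨h1, h2⟩, h3⟩
    refine ⟨fun i => ?_, h2⟩
    rw [subWidth_apply]
    split_ifs
    · linarith
    · exact h1 i

theorem mul_le_one_of_mem_wedge {l x : Fin d → ℝ} (hl : ∀ i, 0 < l i) (hx : x ∈ wedge l)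
    (i : Fin d) : l i * x i ≤ 1 :=
  (Finset.single_le_sum (f := fun i => l i * x i)
    (fun j _ => (mul_pos (hl j) (hx.1 j)).le) (Finset.mem_univ i)).trans hx.2

variable [MeasurableSpace V] (μ : Measure V)

/-- The measure of the part of `A` in the wedge, computed in a parametrization. -/
noncomputable def mass (φ : V →ₗ[ℝ] (Fin d → ℝ)) (l : Fin d → ℝ) (A : Set (Fin d → ℝ)) : ℝ :=
  μ.real {y | φ y ∈ wedge l ∧ φ y ∈ A}

theorem mass_nonneg (φ : V →ₗ[ℝ] (Fin d → ℝ)) (l : Fin d → ℝ) (A : Set (Fin d → ℝ)) :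
    0 ≤ mass μ φ l A := measureReal_nonneg

variable [BorelSpace V] [FiniteDimensional ℝ V]

theorem measurable_coord (φ : V →ₗ[ℝ] (Fin d → ℝ)) (i : Fin d) : Measurable fun y => φ y i :=
  ((continuous_apply i).comp φ.continuous_of_finiteDimensional).measurable

theorem measurableSet_wedge_preimage (φ : V →ₗ[ℝ] (Fin d → ℝ)) (l : Fin d → ℝ) :
    MeasurableSet {y | φ y ∈ wedge l} := by
  have h : {y | φ y ∈ wedge l} = (⋂ i, {y | 0 < φ y i}) ∩ {y | ∑ i, l i * φ y i ≤ 1} := by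
    ext y; simp [wedge]
  rw [h]
  refine MeasurableSet.inter (MeasurableSet.iInter fun i =>
    measurableSet_lt measurable_const (measurable_coord φ i)) (measurableSet_le
      (Finset.measurable_sum _ fun i _ => (measurable_coord φ i).const_mul (l i)) measurable_const)

variable [μ.IsAddHaarMeasure]

theorem measure_wedge_lt_top {φ : V →ₗ[ℝ] (Fin d → ℝ)} (hφ : Function.Injective φ)
    {l : Fin d → ℝ} (hl : ∀ i, 0 < l i) : μ {y | φ y ∈ wedge l} < ⊤ := by
  have hK : IsCompact (Set.Icc (0 : Fin d → ℝ) fun i => 1 / l i) := isCompact_Icc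
  have hemb : Topology.IsClosedEmbedding φ :=
    LinearMap.isClosedEmbedding_of_injective (LinearMap.ker_eq_bot.2 hφ)
  refine lt_of_le_of_lt (measure_mono ?_) (hemb.isCompact_preimage hK).measure_lt_top
  intro y hy
  refine ⟨fun i => (hy.1 i).le, fun i => ?_⟩
  rw [le_div_iff₀ (hl i), mul_comm]
  exact mul_le_one_of_mem_wedge hl hy i

theorem measure_wedge_inter_ne_top {φ : V →ₗ[ℝ] (Fin d → ℝ)} (hφ : Function.Injective φ)
    {l : Fin d → ℝ} (hl : ∀ i, 0 < l i) (A : Set (Fin d → ℝ)) :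
    μ {y | φ y ∈ wedge l ∧ φ y ∈ A} ≠ ⊤ :=
  ((measure_mono fun _ h => h.1).trans_lt (measure_wedge_lt_top μ hφ hl)).ne

theorem mass_mono {φ : V →ₗ[ℝ] (Fin d → ℝ)} (hφ : Function.Injective φ)
    {l : Fin d → ℝ} (hl : ∀ i, 0 < l i) {A B : Set (Fin d → ℝ)} (h : A ⊆ B) :
    mass μ φ l A ≤ mass μ φ l B :=
  measureReal_mono (fun _ hy => ⟨hy.1, h hy.2⟩) (measure_wedge_inter_ne_top μ hφ hl B)

theorem mass_le_univ {φ : V →ₗ[ℝ] (Fin d → ℝ)} (hφ : Function.Injective φ)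
    {l : Fin d → ℝ} (hl : ∀ i, 0 < l i) (A : Set (Fin d → ℝ)) :
    mass μ φ l A ≤ mass μ φ l Set.univ := mass_mono μ hφ hl (Set.subset_univ _)

/-- A linear homogeneous map of rank-one type scales Haar measure explicitly. -/
theorem scaled_transvection_le (f : V →ₗ[ℝ] ℝ) (v : V) {r : ℝ} (hr : 0 < r) {S S' : Set V}
    (h : ∀ y ∈ S, r • (y + f y • v) ∈ S') (hS' : μ S' ≠ ⊤) :
    r ^ Module.finrank ℝ V * |1 + f v| * μ.real S ≤ μ.real S' := by
  -- The map is `r` times a transvection, and a transvection has determinant `1 + f v`.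
  have h1 : (r • LinearMap.transvection f v) '' S ⊆ S' := by
    rintro _ ⟨y, hy, rfl⟩
    simpa [LinearMap.transvection.apply] using h y hy
  have h2 := measureReal_mono h1 hS'
  rw [measureReal_def, Measure.addHaar_image_linearMap, ENNReal.toReal_mul,
    ENNReal.toReal_ofReal (abs_nonneg _), LinearMap.det_smul, LinearMap.transvection.det, abs_mul,
    abs_of_pos (pow_pos hr _)] at h2
  exact h2

/-- The loser of a comparison being narrow, the winner wins with definite probability. -/
theorem mass_split_ge {φ : V →ₗ[ℝ] (Fin d → ℝ)} (hφ : Function.Injective φ)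
    {l : Fin d → ℝ} (hl : ∀ i, 0 < l i) {a c : Fin d} (hac : a ≠ c) {v : V}
    (hv0 : ∀ i, 0 ≤ φ v i) (hva : φ v a = 1) (hvc : φ v c = 0) {C M : ℝ} (hC : 1 ≤ C)
    (hvM : ∑ i, l i * φ v i ≤ 2 * M) (hM : M ≤ C * l c) :
    ((1 + 2 * C)⁻¹) ^ Module.finrank ℝ V * mass μ φ l Set.univ ≤
      mass μ (subWidth a c ∘ₗ φ) (addWeight a c l) Set.univ := by
  have hr : 0 < (1 + 2 * C)⁻¹ := by positivity
  -- Adding `y_c v` makes `a` wider than `c` and leaves the width of `c` alone, so the transvection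
  -- has determinant one. The total weight grows by at most `2 M y_c ≤ 2 C l_c y_c ≤ 2 C`, whence
  -- the factor `(1 + 2 C)⁻¹`.
  have h := scaled_transvection_le μ (LinearMap.proj c ∘ₗ φ) v hr
    (S := {y | φ y ∈ wedge l ∧ φ y ∈ Set.univ})
    (S' := {y | (subWidth a c ∘ₗ φ) y ∈ wedge (addWeight a c l) ∧
      (subWidth a c ∘ₗ φ) y ∈ Set.univ}) ?_
    (measure_wedge_inter_ne_top μ ((subWidth_injective hac).comp hφ) (addWeight_pos a c hl) _)
  · simpa [hvc, mass] using h
  · rintro y ⟨hy, -⟩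
    refine ⟨?_, trivial⟩
    change subWidth a c (φ _) ∈ _
    rw [subWidth_mem_wedge_iff hac]
    simp only [LinearMap.comp_apply, LinearMap.proj_apply, map_smul, map_add]
    refine ⟨⟨fun i => ?_, ?_⟩, ?_⟩
    · simp only [Pi.smul_apply, Pi.add_apply, smul_eq_mul]
      have := mul_nonneg (hy.1 c).le (hv0 i)
      have := hy.1 i
      positivity
    · simp only [Pi.smul_apply, Pi.add_apply, smul_eq_mul]
      have e : ∑ i, l i * ((1 + 2 * C)⁻¹ * (φ y i + φ y c * φ v i)) =
          (1 + 2 * C)⁻¹ * (∑ i, l i * φ y i + φ y c * ∑ i, l i * φ v i) := by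
        rw [mul_add, Finset.mul_sum, Finset.mul_sum, Finset.mul_sum, ← Finset.sum_add_distrib]
        exact Finset.sum_congr rfl fun i _ => by ring
      rw [e, inv_mul_le_iff₀ (by positivity)]
      have h1 := hy.2
      have h2 := mul_le_one_of_mem_wedge hl hy c
      have h3 : φ y c * ∑ i, l i * φ v i ≤ φ y c * (2 * (C * l c)) :=
        mul_le_mul_of_nonneg_left (by linarith) (hy.1 c).le
      have h4 : C * (l c * φ y c) ≤ C * 1 := mul_le_mul_of_nonneg_left h2 (by linarith)
      nlinarith
    · simp only [Pi.smul_apply, Pi.add_apply, smul_eq_mul, hva, hvc]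
      have := hy.1 a
      refine mul_lt_mul_of_pos_left ?_ hr
      linarith

/-- A width is rarely much smaller than the inverse of the weights. -/
theorem mass_narrow_le {φ : V →ₗ[ℝ] (Fin d → ℝ)} (hφ : Function.Injective φ)
    {l : Fin d → ℝ} (hl : ∀ i, 0 < l i) {b : Fin d} {v : V}
    (hv0 : ∀ i, 0 ≤ φ v i) (hvb : φ v b = 1) {M ε : ℝ} (hε : 0 < ε) (hM : 0 < M)
    (hvM : ∑ i, l i * φ v i ≤ 2 * M) :
    mass μ φ l {x | x b ≤ ε / M} ≤ ε * 3 ^ Module.finrank ℝ V * mass μ φ l Set.univ := by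
  -- The narrow part is stretched along `v` by the factor `1 + ε⁻¹`. As `y_b ≤ ε / M`, the added
  -- weight is at most `M⁻¹ * (2 M) = 2`, so division by three returns to the wedge.
  have h := scaled_transvection_le μ (ε⁻¹ • (LinearMap.proj b ∘ₗ φ)) v
    (r := 3⁻¹) (by norm_num) (S := {y | φ y ∈ wedge l ∧ φ y ∈ {x | x b ≤ ε / M}})
    (S' := {y | φ y ∈ wedge l ∧ φ y ∈ Set.univ}) ?_ (measure_wedge_inter_ne_top μ hφ hl _)
  · have h1 : |1 + (ε⁻¹ • (LinearMap.proj b ∘ₗ φ)) v| = 1 + ε⁻¹ := by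
      simp only [LinearMap.smul_apply, LinearMap.comp_apply, LinearMap.proj_apply, hvb, smul_eq_mul,
        mul_one]
      exact abs_of_pos (by positivity)
    rw [h1] at h
    change (3⁻¹) ^ Module.finrank ℝ V * (1 + ε⁻¹) * mass μ φ l {x | x b ≤ ε / M} ≤
      mass μ φ l Set.univ at h
    have h2 : 0 ≤ mass μ φ l {x | x b ≤ ε / M} := mass_nonneg _ _ _ _
    have h3 : (0 : ℝ) < 3 ^ Module.finrank ℝ V := by positivity
    rw [inv_pow] at h
    generalize (3 : ℝ) ^ Module.finrank ℝ V = q at *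
    generalize mass μ φ l {x | x b ≤ ε / M} = m at *
    calc m ≤ ε * q * (q⁻¹ * (1 + ε⁻¹) * m) := by
          have : ε * q * (q⁻¹ * (1 + ε⁻¹) * m) = (1 + ε) * m := by field_simp; ring
          rw [this]; nlinarith
      _ ≤ _ := mul_le_mul_of_nonneg_left h (by positivity)
  · rintro y ⟨hy, hyb⟩
    refine ⟨?_, trivial⟩
    simp only [Set.mem_ofPred_eq, LinearMap.smul_apply, LinearMap.comp_apply, LinearMap.proj_apply,
      map_smul, map_add, smul_eq_mul] at hyb ⊢
    have hb := hy.1 b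
    refine ⟨fun i => ?_, ?_⟩
    · simp only [Pi.smul_apply, Pi.add_apply, smul_eq_mul]
      have := mul_nonneg (mul_nonneg (inv_pos.2 hε).le hb.le) (hv0 i)
      have := hy.1 i
      positivity
    · simp only [Pi.smul_apply, Pi.add_apply, smul_eq_mul]
      have e : ∑ i, l i * (3⁻¹ * (φ y i + ε⁻¹ * φ y b * φ v i)) =
          3⁻¹ * (∑ i, l i * φ y i + ε⁻¹ * φ y b * ∑ i, l i * φ v i) := by
        rw [mul_add, Finset.mul_sum, Finset.mul_sum, Finset.mul_sum, ← Finset.sum_add_distrib]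
        exact Finset.sum_congr rfl fun i _ => by ring
      rw [e]
      have h1 := hy.2
      have h3 : ε⁻¹ * φ y b ≤ M⁻¹ := by
        calc ε⁻¹ * φ y b ≤ ε⁻¹ * (ε / M) := mul_le_mul_of_nonneg_left hyb (inv_pos.2 hε).le
          _ = M⁻¹ := by field_simp
      have h5 : ε⁻¹ * φ y b * ∑ i, l i * φ v i ≤ M⁻¹ * (2 * M) :=
        mul_le_mul h3 hvM
          (Finset.sum_nonneg fun i _ => mul_nonneg (hl i).le (hv0 i)) (inv_pos.2 hM).le
      have h6 : M⁻¹ * (2 * M) = 2 := by field_simp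
      linarith

/-- Coincidence of two widths is a null event unless it is forced. -/
theorem measure_coincidence_eq_zero {φ : V →ₗ[ℝ] (Fin d → ℝ)} {a c : Fin d}
    (h : ∃ y, φ y a ≠ φ y c) : μ {y | φ y a = φ y c} = 0 := by
  let f : V →ₗ[ℝ] ℝ := LinearMap.proj (R := ℝ) (φ := fun _ => ℝ) a ∘ₗ φ -
    LinearMap.proj (R := ℝ) (φ := fun _ => ℝ) c ∘ₗ φ
  have h1 : {y | φ y a = φ y c} = (LinearMap.ker f : Set V) := by
    ext y; simp [f, sub_eq_zero]
  rw [h1]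
  refine Measure.addHaar_submodule μ _ fun htop => ?_
  obtain ⟨y, hy⟩ := h
  have : f y = 0 := by
    rw [← LinearMap.mem_ker, htop]; trivial
  apply hy
  simpa [f, sub_eq_zero] using this

/-- Decomposition of a set by the outcome of the first comparison. -/
theorem mass_le_split_add_split {φ : V →ₗ[ℝ] (Fin d → ℝ)} (hφ : Function.Injective φ)
    {l : Fin d → ℝ} (hl : ∀ i, 0 < l i) {a c : Fin d} (hac : a ≠ c)
    (h0 : μ {y | φ y a = φ y c} = 0) {A A₁ A₂ : Set (Fin d → ℝ)}
    (h1 : ∀ x ∈ A, (∀ i, 0 < x i) → x c < x a → subWidth a c x ∈ A₁)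
    (h2 : ∀ x ∈ A, (∀ i, 0 < x i) → x a < x c → subWidth c a x ∈ A₂) :
    mass μ φ l A ≤ mass μ (subWidth a c ∘ₗ φ) (addWeight a c l) A₁ +
      mass μ (subWidth c a ∘ₗ φ) (addWeight c a l) A₂ := by
  have f1 := measure_wedge_inter_ne_top μ (φ := subWidth a c ∘ₗ φ)
    ((subWidth_injective hac).comp hφ) (addWeight_pos a c hl) A₁
  have f2 := measure_wedge_inter_ne_top μ (φ := subWidth c a ∘ₗ φ) ((subWidth_injective hac.symm).comp hφ)
    (addWeight_pos c a hl) A₂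
  have hsub : {y | φ y ∈ wedge l ∧ φ y ∈ A} ⊆ {y | φ y a = φ y c} ∪
      ({y | (subWidth a c ∘ₗ φ) y ∈ wedge (addWeight a c l) ∧ (subWidth a c ∘ₗ φ) y ∈ A₁} ∪
       {y | (subWidth c a ∘ₗ φ) y ∈ wedge (addWeight c a l) ∧ (subWidth c a ∘ₗ φ) y ∈ A₂}) := by
    rintro y ⟨hy, hyA⟩
    rcases lt_trichotomy (φ y a) (φ y c) with h | h | h
    · exact Or.inr (Or.inr ⟨(subWidth_mem_wedge_iff hac.symm).2 ⟨hy, h⟩, h2 _ hyA hy.1 h⟩)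
    · exact Or.inl h
    · exact Or.inr (Or.inl ⟨(subWidth_mem_wedge_iff hac).2 ⟨hy, h⟩, h1 _ hyA hy.1 h⟩)
  have h3 := measureReal_mono (μ := μ) hsub
    (measure_union_ne_top (by rw [h0]; simp) (measure_union_ne_top f1 f2))
  refine h3.trans ((measureReal_union_le _ _).trans ?_)
  rw [measureReal_def μ {y | φ y a = φ y c}, h0, ENNReal.toReal_zero, zero_add]
  exact measureReal_union_le _ _

theorem mass_split_add_split_le {φ : V →ₗ[ℝ] (Fin d → ℝ)} (hφ : Function.Injective φ)
    {l : Fin d → ℝ} (hl : ∀ i, 0 < l i) {a c : Fin d} (hac : a ≠ c) :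
    mass μ (subWidth a c ∘ₗ φ) (addWeight a c l) Set.univ +
      mass μ (subWidth c a ∘ₗ φ) (addWeight c a l) Set.univ ≤ mass μ φ l Set.univ := by
  have f1 := measure_wedge_lt_top μ (φ := subWidth a c ∘ₗ φ) ((subWidth_injective hac).comp hφ)
    (addWeight_pos a c hl)
  have f2 := measure_wedge_lt_top μ (φ := subWidth c a ∘ₗ φ)
    ((subWidth_injective hac.symm).comp hφ) (addWeight_pos c a hl)
  simp only [mass, Set.mem_univ, and_true]
  rw [← measureReal_union (Set.disjoint_left.2 ?_) (measurableSet_wedge_preimage _ _) f1.ne f2.ne]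
  · refine measureReal_mono ?_ (measure_wedge_lt_top μ hφ hl).ne
    rintro y (hy | hy)
    · exact ((subWidth_mem_wedge_iff hac).1 hy).1
    · exact ((subWidth_mem_wedge_iff hac.symm).1 hy).1
  · intro y h1 h2
    exact lt_asymm ((subWidth_mem_wedge_iff hac).1 h1).2 ((subWidth_mem_wedge_iff hac.symm).1 h2).2

end Mass

end NonclassicalIET

namespace NonclassicalIET

/-! ### Recurrent classes, short vectors, and improvement along paths. -/

section Recurrence

set_option linter.unusedSectionVars false

variable {d : ℕ}

/-- The split of `π` on the side `s` is realized by positive widths satisfying the switch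
condition. -/
def CanSplit (π : Combinatorics d) (s : Side) : Prop :=
  ∃ a c x, π.crit s = some a ∧ π.crit s.opp = some c ∧ (∀ i, 0 < x i) ∧ π.Switch x ∧ x c < x a

/-- A target is attained from `π` by a path of at most `k` realized splits. -/
def AttainsIn (Q : Combinatorics d → Prop) : ℕ → Combinatorics d → Prop
  | 0, π => Q π
  | k + 1, π => Q π ∨ ∃ s, CanSplit π s ∧ AttainsIn Q k (π.split s)

theorem AttainsIn.mono_target {Q Q' : Combinatorics d → Prop} (h : ∀ π, Q π → Q' π) {k : ℕ}
    {π : Combinatorics d} (hk : AttainsIn Q k π) : AttainsIn Q' k π := by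
  induction k generalizing π with
  | zero => exact h _ hk
  | succ k ih =>
    rcases hk with hk | ⟨s, hs, hk⟩
    · exact Or.inl (h _ hk)
    · exact Or.inr ⟨s, hs, ih hk⟩

theorem AttainsIn.mono {Q : Combinatorics d → Prop} {k m : ℕ} (hkm : k ≤ m)
    {π : Combinatorics d} (hk : AttainsIn Q k π) : AttainsIn Q m π := by
  induction k generalizing π m with
  | zero =>
    cases m with
    | zero => exact hk
    | succ m => exact Or.inl hk
  | succ k ih =>
    obtain ⟨m, rfl⟩ : ∃ n, m = n + 1 := ⟨m - 1, by omega⟩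
    rcases hk with hk | ⟨s, hs, hk⟩
    · exact Or.inl hk
    · exact Or.inr ⟨s, hs, ih (by omega) hk⟩

theorem exists_uniform_attainsIn {R : Set (Combinatorics d)} (hR : R.Finite)
    {Q : Combinatorics d → Prop} (h : ∀ π ∈ R, ∃ k, AttainsIn Q k π) :
    ∃ k, ∀ π ∈ R, AttainsIn Q k π := by
  induction R, hR using Set.Finite.induction_on with
  | empty => exact ⟨0, by simp⟩
  | @insert π R _ _ ih =>
    obtain ⟨k, hk⟩ := ih fun π' hπ' => h π' (Set.mem_insert_of_mem _ hπ')
    obtain ⟨m, hm⟩ := h π (Set.mem_insert _ _)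
    refine ⟨max k m, fun π' hπ' => ?_⟩
    rcases hπ' with rfl | hπ'
    · exact hm.mono (le_max_right _ _)
    · exact (hk π' hπ').mono (le_max_left _ _)

/-- A finite set of labelled types closed under realized splits, together with the set `D` of labels
which are never critical in it. The vertex `p` is attained from everywhere. -/
structure IsRecurrentClass (R : Set (Combinatorics d)) (D : Finset (Fin d)) (p : ReducedType d) :
    Prop where
  finite : R.Finite
  labelled : ∀ π ∈ R, π.IsLabelled
  canSplit : ∀ π ∈ R, ∃ s, CanSplit π s
  closed : ∀ π ∈ R, ∀ s, CanSplit π s → π.split s ∈ R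
  crit_notMem : ∀ π ∈ R, ∀ s a, π.crit s = some a → a ∉ D
  decoupled : ∀ π ∈ R, (∀ α ∈ D, π.coef .top α = 0) ∨ (∀ α ∉ D, π.coef .top α = 0)
  attains_crit : ∀ α ∉ D, ∀ π ∈ R, ∃ k, AttainsIn (fun π' => ∃ s, π'.crit s = some α) k π
  attains_vertex : ∀ π ∈ R, ∃ k, AttainsIn (fun π' => (⟦π'⟧ : ReducedType d) = p) k π

namespace IsRecurrentClass

variable {R : Set (Combinatorics d)} {D : Finset (Fin d)} {p : ReducedType d}

theorem exists_crit (hR : IsRecurrentClass R D p) {π : Combinatorics d} (hπ : π ∈ R) (s : Side) :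
    ∃ a c x, π.crit s = some a ∧ π.crit s.opp = some c ∧ (∀ i, 0 < x i) ∧ π.Switch x ∧
      x a ≠ x c := by
  obtain ⟨t, a, c, x, ha, hc, hx, hsw, hlt⟩ := hR.canSplit π hπ
  rcases Side.eq_or_eq_opp s t with rfl | rfl
  · exact ⟨a, c, x, ha, hc, hx, hsw, hlt.ne'⟩
  · exact ⟨c, a, x, by simpa using hc, ha, hx, hsw, hlt.ne⟩

theorem ne_of_crit (hR : IsRecurrentClass R D p) {π : Combinatorics d} (hπ : π ∈ R) {s : Side}
    {a c : Fin d} (ha : π.crit s = some a) (hc : π.crit s.opp = some c) : a ≠ c := by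
  obtain ⟨a', c', x, ha', hc', -, -, hne⟩ := hR.exists_crit hπ s
  rw [ha] at ha'; rw [hc] at hc'
  cases ha'; cases hc'
  rintro rfl
  exact hne rfl

end IsRecurrentClass

/-- A positive solution of the switch condition yields a label of opposite sign outside every set of
labels of small total width. -/
theorem exists_coef_eq_neg {π : Combinatorics d} (hπ : π.IsLabelled) {x : Fin d → ℝ}
    (hx : ∀ i, 0 < x i) (hsw : π.Switch x) {s : Side} {b : Fin d} (hb : π.coef s b ≠ 0)
    {X : Finset (Fin d)} (hX : ∑ i ∈ X, x i < x b) (hbX : b ∉ X) :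
    ∃ b' ∉ X, π.coef s b' = -π.coef s b := by
  by_contra! hcon
  have ht : π.coef s b * π.coef s b = 4 := by
    rcases hπ.coef_trichotomy s b with h | h | h
    · exact absurd h hb
    · rw [h]; norm_num
    · rw [h]; norm_num
  -- Normalized in this way, the coefficients lie in `{-1, 0, 1}` and that of `b` is one. If no
  -- label outside `X` had coefficient minus one, the sum over `X` would have to cancel `x b`, which
  -- it is too small to do.
  have h0 : ∑ i, π.coef s i * π.coef s b / 4 * x i = 0 := by
    rw [Combinatorics.switch_iff π s, Combinatorics.sw_eq_sum] at hsw
    calc ∑ i, π.coef s i * π.coef s b / 4 * x i = π.coef s b / 4 * ∑ i, π.coef s i * x i := by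
          rw [Finset.mul_sum]; exact Finset.sum_congr rfl fun i _ => by ring
      _ = 0 := by rw [hsw, mul_zero]
  have h1 : ∀ i ∈ X, -x i ≤ π.coef s i * π.coef s b / 4 * x i := by
    intro i _
    have : -1 ≤ π.coef s i * π.coef s b / 4 := by
      rcases hπ.coef_trichotomy s i with h | h | h <;>
        rcases hπ.coef_trichotomy s b with h' | h' | h' <;> rw [h, h'] <;> norm_num
    nlinarith [hx i]
  have h2 : ∀ i ∈ Xᶜ, 0 ≤ π.coef s i * π.coef s b / 4 * x i := by
    intro i hi
    have h3 := hcon i (by simpa using hi)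
    have : 0 ≤ π.coef s i * π.coef s b / 4 := by
      rcases hπ.coef_trichotomy s i with h | h | h <;>
        rcases hπ.coef_trichotomy s b with h' | h' | h' <;> rw [h, h'] at h3 ⊢ <;>
        first
          | (norm_num; done)
          | exact absurd (by norm_num) h3
    exact mul_nonneg this (hx i).le
  have h4 : x b ≤ ∑ i ∈ Xᶜ, π.coef s i * π.coef s b / 4 * x i := by
    refine le_trans ?_ (Finset.single_le_sum h2 (by simpa using hbX : b ∈ Xᶜ))
    rw [ht]; linarith
  have h5 := Finset.sum_le_sum h1
  rw [Finset.sum_neg_distrib] at h5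
  rw [← Finset.sum_add_sum_compl X] at h0
  linarith

namespace IsRecurrentClass

variable {R : Set (Combinatorics d)} {D : Finset (Fin d)} {p : ReducedType d}

/-- A short vector of the cone of widths through a given label. -/
theorem exists_ray (hR : IsRecurrentClass R D p) {π : Combinatorics d} (hπ : π ∈ R)
    {x : Fin d → ℝ} (hx : ∀ i, 0 < x i) (hsw : π.Switch x) {b : Fin d} (hbD : b ∉ D)
    {X : Finset (Fin d)} (hX : ∑ i ∈ X, x i < x b) (hbX : b ∉ X) :
    ∃ v : Fin d → ℝ, π.Switch v ∧ (∀ i, 0 ≤ v i) ∧ v b = 1 ∧ (∀ i ∈ X, v i = 0) ∧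
      ∀ (l : Fin d → ℝ) (M : ℝ), (∀ i, 0 < l i) → (∀ i ∉ D, l i ≤ M) →
        ∑ i, l i * v i ≤ 2 * M := by
  have hlab := hR.labelled π hπ
  by_cases h0 : π.coef .top b = 0
  · refine ⟨Pi.single b 1, ?_, ?_, by simp, ?_, ?_⟩
    · rw [Combinatorics.switch_iff π .top, Combinatorics.sw_single, h0, zero_mul]
    · intro i
      rw [Pi.single_apply]
      split_ifs <;> norm_num
    · intro i hi
      rw [Pi.single_apply, if_neg (by rintro rfl; exact hbX hi)]
    · intro l M hl hM
      simp only [Pi.single_apply, mul_ite, mul_one, mul_zero, Finset.sum_ite_eq', Finset.mem_univ,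
        if_true]
      linarith [hM b hbD, hl b]
  -- A reversing label must be balanced by one on the other side. The vector then involves two
  -- labels, both outside `D` by decoupling, which is the source of the bound `2 * M`.
  · obtain ⟨b', hb'X, hb'⟩ := exists_coef_eq_neg hlab hx hsw h0 hX hbX
    have hbb : b ≠ b' := by
      rintro rfl
      exact h0 (by linarith)
    have hb'D : b' ∉ D := by
      rcases hR.decoupled π hπ with h | h
      · intro hmem
        exact h0 (by linarith [h b' hmem])
      · exact absurd (h b hbD) h0
    refine ⟨Pi.single b 1 + Pi.single b' 1, ?_, ?_, ?_, ?_, ?_⟩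
    · rw [Combinatorics.switch_iff π .top, map_add, Combinatorics.sw_single,
        Combinatorics.sw_single, hb']
      ring
    · intro i
      simp only [Pi.add_apply, Pi.single_apply]
      split_ifs <;> norm_num
    · simp [hbb]
    · intro i hi
      have h1 : i ≠ b := by rintro rfl; exact hbX hi
      have h2 : i ≠ b' := by rintro rfl; exact hb'X hi
      simp [h1, h2]
    · intro l M hl hM
      simp only [Pi.add_apply, Pi.single_apply, mul_add, mul_ite, mul_one, mul_zero,
        Finset.sum_add_distrib, Finset.sum_ite_eq', Finset.mem_univ, if_true]
      linarith [hM b hbD, hM b' hb'D]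

variable {V : Type*} [NormedAddCommGroup V] [NormedSpace ℝ V] [MeasurableSpace V] [BorelSpace V]
  [FiniteDimensional ℝ V] (μ : Measure V) [μ.IsAddHaarMeasure]

theorem mass_split_ge (hR : IsRecurrentClass R D p) {π : Combinatorics d} (hπ : π ∈ R) {s : Side}
    (hs : CanSplit π s) {a c : Fin d} (ha : π.crit s = some a) (hc : π.crit s.opp = some c)
    {φ : V →ₗ[ℝ] (Fin d → ℝ)} (hφ : Parametrizes φ π) {l : Fin d → ℝ} (hl : ∀ i, 0 < l i)
    {C M : ℝ} (hC : 1 ≤ C) (hM : ∀ i ∉ D, l i ≤ M) (hcM : M ≤ C * l c) :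
    ((1 + 2 * C)⁻¹) ^ Module.finrank ℝ V * mass μ φ l Set.univ ≤
      mass μ (subWidth a c ∘ₗ φ) (addWeight a c l) Set.univ := by
  have hac := hR.ne_of_crit hπ ha hc
  obtain ⟨a', c', x, ha', hc', hx, hsw, hlt⟩ := hs
  rw [ha] at ha'; rw [hc] at hc'
  cases ha'; cases hc'
  -- Since `x c < x a`, the set `{c}` is narrow enough for the vector through `a` to avoid `c`.
  obtain ⟨v, hv, hv0, hva, hvc, hvM⟩ := hR.exists_ray hπ hx hsw (hR.crit_notMem π hπ s a ha)
    (X := {c}) (by simpa using hlt) (by simpa using hac)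
  obtain ⟨v, rfl⟩ := (hφ.mem_range v).2 hv
  exact NonclassicalIET.mass_split_ge μ hφ.injective hl hac hv0 hva (hvc c (by simp)) hC
    (hvM l M hl hM) hcM

theorem mass_narrow_le (hR : IsRecurrentClass R D p) {π : Combinatorics d} (hπ : π ∈ R)
    {φ : V →ₗ[ℝ] (Fin d → ℝ)} (hφ : Parametrizes φ π) {l : Fin d → ℝ} (hl : ∀ i, 0 < l i)
    {M ε : ℝ} (hε : 0 < ε) (hM : ∀ i ∉ D, l i ≤ M) {b : Fin d} (hb : b ∉ D) :
    mass μ φ l {x | x b ≤ ε / M} ≤ ε * 3 ^ Module.finrank ℝ V * mass μ φ l Set.univ := by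
  obtain ⟨_, _, x, -, -, hx, hsw, -⟩ := hR.exists_crit hπ .top
  obtain ⟨v, hv, hv0, hva, -, hvM⟩ := hR.exists_ray hπ hx hsw hb (X := ∅) (by simpa using hx b)
    (by simp)
  obtain ⟨v, rfl⟩ := (hφ.mem_range v).2 hv
  exact NonclassicalIET.mass_narrow_le μ hφ.injective hl hv0 hva hε ((hl b).trans_le (hM b hb))
    (hvM l M hl hM)

theorem measure_coincidence_eq_zero (hR : IsRecurrentClass R D p) {π : Combinatorics d}
    (hπ : π ∈ R) {s : Side} {a c : Fin d} (ha : π.crit s = some a) (hc : π.crit s.opp = some c)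
    {φ : V →ₗ[ℝ] (Fin d → ℝ)} (hφ : Parametrizes φ π) : μ {y | φ y a = φ y c} = 0 := by
  obtain ⟨a', c', x, ha', hc', -, hsw, hne⟩ := hR.exists_crit hπ s
  rw [ha] at ha'; rw [hc] at hc'
  cases ha'; cases hc'
  obtain ⟨y, rfl⟩ := (hφ.mem_range x).2 hsw
  exact NonclassicalIET.measure_coincidence_eq_zero μ ⟨y, hne⟩

/-- Either a split is realized, or it has no mass. -/
theorem canSplit_or_mass_eq_zero {π : Combinatorics d} {s : Side} {a c : Fin d}
    (ha : π.crit s = some a) (hc : π.crit s.opp = some c) (hac : a ≠ c)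
    {φ : V →ₗ[ℝ] (Fin d → ℝ)} (hφ : Parametrizes φ π) (l : Fin d → ℝ) :
    CanSplit π s ∨ ∀ A, mass μ (subWidth a c ∘ₗ φ) (addWeight a c l) A = 0 := by
  by_cases h : ∃ y, (subWidth a c ∘ₗ φ) y ∈ wedge (addWeight a c l)
  · obtain ⟨y, hy⟩ := h
    obtain ⟨h1, h2⟩ := (subWidth_mem_wedge_iff hac).1 hy
    exact Or.inl ⟨a, c, φ y, ha, hc, h1.1, (hφ.mem_range _).1 ⟨y, rfl⟩, h2⟩
  · push Not at h
    refine Or.inr fun A => ?_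
    simp only [mass, h, false_and, Set.ofPred_false, measureReal_empty]

end IsRecurrentClass

variable {V : Type*} [NormedAddCommGroup V] [NormedSpace ℝ V] [MeasurableSpace V] [BorelSpace V]
  [FiniteDimensional ℝ V] (μ : Measure V) [μ.IsAddHaarMeasure]

/-- A family of sets of widths that is carried into itself by splits. -/
def SplitInvariant (B : Combinatorics d → Set (Fin d → ℝ)) : Prop :=
  ∀ π s a c x, π.crit s = some a → π.crit s.opp = some c → x c < x a → x ∈ B π →
    subWidth a c x ∈ B (π.split s)

/-- The sets `B π` occupy at most the proportion `u` of every wedge. -/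
def MassBound (R : Set (Combinatorics d)) (B : Combinatorics d → Set (Fin d → ℝ)) (u : ℝ) : Prop :=
  ∀ π ∈ R, ∀ φ : V →ₗ[ℝ] (Fin d → ℝ), Parametrizes φ π → ∀ l : Fin d → ℝ, (∀ i, 0 < l i) →
    mass μ φ l (B π) ≤ u * mass μ φ l Set.univ

/-- At all states satisfying `P`, a bound for the family `B` improves by a definite factor for the
family `A`. -/
def Improves (R : Set (Combinatorics d)) (B A : Combinatorics d → Set (Fin d → ℝ))
    (P : Combinatorics d → (Fin d → ℝ) → Prop) : Prop :=
  ∃ ε : ℝ, 0 < ε ∧ ε ≤ 1 ∧ ∀ u, 0 ≤ u → MassBound μ R B u → ∀ π ∈ R,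
    ∀ φ : V →ₗ[ℝ] (Fin d → ℝ), Parametrizes φ π → ∀ l : Fin d → ℝ, (∀ i, 0 < l i) → P π l →
      mass μ φ l (A π) ≤ (1 - ε) * u * mass μ φ l Set.univ

namespace IsRecurrentClass

variable {R : Set (Combinatorics d)} {D : Finset (Fin d)} {p : ReducedType d}
  {B : Combinatorics d → Set (Fin d → ℝ)}

theorem mass_split_le (hR : IsRecurrentClass R D p) {u : ℝ} (hu : MassBound μ R B u)
    {π : Combinatorics d} (hπ : π ∈ R) {s : Side} {a c : Fin d} (ha : π.crit s = some a)
    (hc : π.crit s.opp = some c) {φ : V →ₗ[ℝ] (Fin d → ℝ)} (hφ : Parametrizes φ π)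
    {l : Fin d → ℝ} (hl : ∀ i, 0 < l i) :
    mass μ (subWidth a c ∘ₗ φ) (addWeight a c l) (B (π.split s)) ≤
      u * mass μ (subWidth a c ∘ₗ φ) (addWeight a c l) Set.univ := by
  have hac := hR.ne_of_crit hπ ha hc
  rcases canSplit_or_mass_eq_zero μ ha hc hac hφ l with h | h
  · exact hu _ (hR.closed π hπ s h) _ (hφ.split ha hc hac) _ (addWeight_pos a c hl)
  · rw [h, h, mul_zero]

/-- Improvement after one split is inherited, in proportion to the probability of the split. -/
theorem mass_le_of_split (hR : IsRecurrentClass R D p) (hB : SplitInvariant B) {u : ℝ}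
    (hu0 : 0 ≤ u) (hu : MassBound μ R B u) {π : Combinatorics d} (hπ : π ∈ R) {s : Side}
    {a c : Fin d} (ha : π.crit s = some a)
    (hc : π.crit s.opp = some c) {φ : V →ₗ[ℝ] (Fin d → ℝ)} (hφ : Parametrizes φ π)
    {l : Fin d → ℝ} (hl : ∀ i, 0 < l i) {A A' : Set (Fin d → ℝ)} (hA : A ⊆ B π)
    (hA' : ∀ x ∈ A, (∀ i, 0 < x i) → x c < x a → subWidth a c x ∈ A') {ε κ : ℝ} (hε : 0 ≤ ε)
    (hκ : κ * mass μ φ l Set.univ ≤ mass μ (subWidth a c ∘ₗ φ) (addWeight a c l) Set.univ)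
    (h : mass μ (subWidth a c ∘ₗ φ) (addWeight a c l) A' ≤
      (1 - ε) * u * mass μ (subWidth a c ∘ₗ φ) (addWeight a c l) Set.univ) :
    mass μ φ l A ≤ (1 - κ * ε) * u * mass μ φ l Set.univ := by
  have hac := hR.ne_of_crit hπ ha hc
  have ha' : π.crit s.opp.opp = some a := by simpa using ha
  have h1 := mass_le_split_add_split μ hφ.injective hl hac
    (hR.measure_coincidence_eq_zero μ hπ ha hc hφ) (A := A) (A₁ := A') (A₂ := B (π.split s.opp)) hA'
    fun x hx _ hlt => hB π s.opp c a x hc ha' hlt (hA hx)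
  have h2 := hR.mass_split_le μ hu hπ hc ha' hφ hl
  have h3 := mass_split_add_split_le μ hφ.injective hl hac
  -- With `m₁`, `m₂` the masses of the two outcomes, the total is at most `(1 - ε) u m₁ + u m₂`,
  -- where `m₁ + m₂ ≤ m` and `κ m ≤ m₁`.
  have h4 := mul_le_mul_of_nonneg_left h3 hu0
  have h5 := mul_le_mul_of_nonneg_left hκ (mul_nonneg hu0 hε)
  linarith

/-- The labels outside `D` whose weight is small relative to `M`. -/
noncomputable def light (D : Finset (Fin d)) (C M : ℝ) (l : Fin d → ℝ) : Finset (Fin d) :=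
  Finset.univ.filter fun i => i ∉ D ∧ C * l i < M

theorem mem_light {C M : ℝ} {l : Fin d → ℝ} {i : Fin d} :
    i ∈ light D C M l ↔ i ∉ D ∧ C * l i < M := by simp [light]

theorem le_of_notMem_light {C M : ℝ} {l : Fin d → ℝ} {i : Fin d} (hi : i ∉ D)
    (h : i ∉ light D C M l) : M ≤ C * l i := by
  rw [mem_light] at h
  push Not at h
  exact h hi

theorem addWeight_le_two_mul (hR : IsRecurrentClass R D p) {π : Combinatorics d} (hπ : π ∈ R)
    {s : Side} {a c : Fin d} (ha : π.crit s = some a)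
    (hc : π.crit s.opp = some c) {l : Fin d → ℝ} (hl : ∀ i, 0 < l i) {M : ℝ}
    (hM : ∀ i ∉ D, l i ≤ M) : ∀ i ∉ D, addWeight a c l i ≤ 2 * M := by
  intro i hi
  have h1 := hM i hi
  have h2 := hM a (hR.crit_notMem π hπ _ _ ha)
  have h3 := hM c (hR.crit_notMem π hπ _ _ hc)
  have h4 := hl i
  rw [addWeight_apply]
  split_ifs <;> linarith

/-- Doubling both constants leaves the threshold `M / C` unchanged, and the only weight that changes
belongs to a label that was heavy and stays heavy. -/
theorem light_addWeight {a c : Fin d} {C M : ℝ} {l : Fin d → ℝ} (hC : 0 ≤ C) (hl : ∀ i, 0 < l i)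
    (hcM : M ≤ C * l c) : light D (2 * C) (2 * M) (addWeight a c l) = light D C M l := by
  ext i
  rw [mem_light, mem_light, addWeight_apply]
  split_ifs with h
  · subst h
    have := mul_nonneg hC (hl a).le
    constructor <;> rintro ⟨h1, h2⟩ <;> exact ⟨h1, by nlinarith⟩
  · constructor <;> rintro ⟨h1, h2⟩ <;> exact ⟨h1, by nlinarith⟩

/-- As long as the target `Q` is not attained, `hQ` makes both critical labels heavy, so the next
split of the path has definite probability and preserves the set of light labels. The comparability
constant only doubles at each of the boundedly many splits. -/
theorem improves_of_path (hR : IsRecurrentClass R D p) (hB : SplitInvariant B) (j : ℕ)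
    (Q : Finset (Fin d) → Combinatorics d → Prop)
    (hQ : ∀ π ∈ R, ∀ S : Finset (Fin d), S.card ≤ j → ¬Q S π → ∀ s a, π.crit s = some a → a ∉ S)
    (hbase : ∀ C, 1 ≤ C → Improves μ R B B fun π l => ∃ M, (∀ i ∉ D, l i ≤ M) ∧
      (light D C M l).card ≤ j ∧ Q (light D C M l) π) (k : ℕ) :
    ∀ C, 1 ≤ C → Improves μ R B B fun π l => ∃ M, (∀ i ∉ D, l i ≤ M) ∧
      (light D C M l).card ≤ j ∧ AttainsIn (Q (light D C M l)) k π := by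
  induction k with
  | zero => exact hbase
  | succ k ih =>
    intro C hC
    obtain ⟨ε₀, h0, h0', hε₀⟩ := hbase C hC
    obtain ⟨ε₁, h1, h1', hε₁⟩ := ih (2 * C) (by linarith)
    set κ := ((1 + 2 * C)⁻¹) ^ Module.finrank ℝ V with hκ
    have hκ0 : 0 < κ := by positivity
    refine ⟨min ε₀ (κ * ε₁), lt_min h0 (by positivity), (min_le_left _ _).trans h0', ?_⟩
    rintro u hu0 hu π hπ φ hφ l hl ⟨M, hM, hcard, hpath⟩
    have hm : 0 ≤ u * mass μ φ l Set.univ := mul_nonneg hu0 (mass_nonneg _ _ _ _)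
    by_cases hq : Q (light D C M l) π
    · have := hε₀ u hu0 hu π hπ φ hφ l hl ⟨M, hM, hcard, hq⟩
      have h2 := mul_le_mul_of_nonneg_right (min_le_left ε₀ (κ * ε₁)) hm
      linarith
    · rcases hpath with hpath | ⟨s, hs, hpath⟩
      · exact absurd hpath hq
      obtain ⟨a, c, -, ha, hc, -⟩ := hR.exists_crit hπ s
      have hac := hR.ne_of_crit hπ ha hc
      -- The loser is critical and the target is not yet attained, hence the loser is heavy.
      have hcM : M ≤ C * l c :=
        le_of_notMem_light (hR.crit_notMem π hπ _ _ hc) (hQ π hπ _ hcard hq _ _ hc)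
      have hlight := light_addWeight (D := D) (a := a) (by linarith) hl hcM
      have h3 := hε₁ u hu0 hu _ (hR.closed π hπ s hs) _ (hφ.split ha hc hac) _
        (addWeight_pos a c hl) ⟨2 * M, hR.addWeight_le_two_mul hπ ha hc hl hM, by rwa [hlight],
          by rwa [hlight]⟩
      have h4 := hR.mass_le_of_split μ hB hu0 hu hπ ha hc hφ hl le_rfl
        (fun x hx _ hlt => hB π s a c x ha hc hlt hx) h1.le
        (hR.mass_split_ge μ hπ hs ha hc hφ hl hC hM hcM) h3
      have h2 := mul_le_mul_of_nonneg_right (min_le_right ε₀ (κ * ε₁)) hm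
      linarith

end IsRecurrentClass

end Recurrence

end NonclassicalIET

namespace NonclassicalIET

/-! ### Hitting times, and equalization of light weights. -/

section Hitting

set_option linter.unusedSectionVars false

variable {d : ℕ}

/-- The widths whose expansion, started at type `π` with weights `l`, meets the condition `P` on
types and weights within `k` splits. -/
def HitsIn (P : Combinatorics d → (Fin d → ℝ) → Prop) :
    ℕ → Combinatorics d → (Fin d → ℝ) → Set (Fin d → ℝ)
  | 0, π, l => {_x | P π l}
  | k + 1, π, l => {x | P π l ∨ ∃ s a c, π.crit s = some a ∧ π.crit s.opp = some c ∧ x c < x a ∧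
      subWidth a c x ∈ HitsIn P k (π.split s) (addWeight a c l)}

theorem mem_hitsIn_of {P : Combinatorics d → (Fin d → ℝ) → Prop} {π : Combinatorics d}
    {l : Fin d → ℝ} (h : P π l) (k : ℕ) (x : Fin d → ℝ) : x ∈ HitsIn P k π l := by
  cases k with
  | zero => exact h
  | succ k => exact Or.inl h

theorem hitsIn_subset_succ (P : Combinatorics d → (Fin d → ℝ) → Prop) (k : ℕ)
    (π : Combinatorics d) (l : Fin d → ℝ) : HitsIn P k π l ⊆ HitsIn P (k + 1) π l := by
  induction k generalizing π l with
  | zero => exact fun x hx => Or.inl hx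
  | succ k ih =>
    rintro x (hx | ⟨s, a, c, ha, hc, hlt, hx⟩)
    · exact Or.inl hx
    · exact Or.inr ⟨s, a, c, ha, hc, hlt, ih _ _ hx⟩

/-- The expansion makes at least `k` splits. -/
def Survives : ℕ → Combinatorics d → (Fin d → ℝ) → Prop
  | 0, _, _ => True
  | k + 1, π, x => ∃ s a c, π.crit s = some a ∧ π.crit s.opp = some c ∧ x c < x a ∧
      Survives k (π.split s) (subWidth a c x)

/-- The split performed at given widths is unique. -/
theorem split_unique {π : Combinatorics d} {x : Fin d → ℝ} {s s' : Side} {a c a' c' : Fin d}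
    (ha : π.crit s = some a) (hc : π.crit s.opp = some c) (h : x c < x a)
    (ha' : π.crit s' = some a') (hc' : π.crit s'.opp = some c') (h' : x c' < x a') :
    s' = s ∧ a' = a ∧ c' = c := by
  rcases Side.eq_or_eq_opp s s' with rfl | rfl
  · rw [ha] at ha'; rw [hc] at hc'
    cases ha'; cases hc'
    exact ⟨rfl, rfl, rfl⟩
  · rw [Side.opp_opp, ha] at hc'; rw [hc] at ha'
    cases ha'; cases hc'
    exact absurd h (lt_asymm h')

variable {V : Type*} [NormedAddCommGroup V] [NormedSpace ℝ V] [MeasurableSpace V] [BorelSpace V]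
  [FiniteDimensional ℝ V] (μ : Measure V) [μ.IsAddHaarMeasure]

namespace IsRecurrentClass

variable {R : Set (Combinatorics d)} {D : Finset (Fin d)} {p : ReducedType d}
  {B : Combinatorics d → Set (Fin d → ℝ)}

/-- The expansion of positive widths can stop only when the two critical widths coincide. At each
type this is a proper hyperplane, because some switch solution separates the two widths. -/
theorem measure_not_survives (hR : IsRecurrentClass R D p) (k : ℕ) {π : Combinatorics d}
    (hπ : π ∈ R) {φ : V →ₗ[ℝ] (Fin d → ℝ)} (hφ : Parametrizes φ π) :
    μ {y | (∀ i, 0 < φ y i) ∧ ¬Survives k π (φ y)} = 0 := by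
  induction k generalizing π φ with
  | zero => simp [Survives]
  | succ k ih =>
    have key : ∀ s a c, π.crit s = some a → π.crit s.opp = some c →
        μ {y | (∀ i, 0 < φ y i) ∧ φ y c < φ y a ∧
          ¬Survives k (π.split s) (subWidth a c (φ y))} = 0 := by
      intro s a c ha hc
      have hac := hR.ne_of_crit hπ ha hc
      by_cases hs : CanSplit π s
      · refine measure_mono_null ?_ (ih (hR.closed π hπ s hs) (hφ.split ha hc hac))
        rintro y ⟨h1, h2, h3⟩
        refine ⟨fun i => ?_, h3⟩
        rw [LinearMap.comp_apply, subWidth_apply]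
        split_ifs
        · linarith
        · exact h1 i
      · refine measure_mono_null (t := ∅) ?_ measure_empty
        rintro y ⟨h1, h2, -⟩
        exact hs ⟨a, c, φ y, ha, hc, h1, (hφ.mem_range _).1 ⟨y, rfl⟩, h2⟩
    obtain ⟨a, c, -, ha, hc, -⟩ := hR.exists_crit hπ .top
    have hc' : π.crit Side.top.opp.opp = some a := ha
    refine measure_mono_null ?_ (measure_union_null (hR.measure_coincidence_eq_zero μ hπ ha hc hφ)
      (measure_union_null (key .top a c ha hc) (key Side.top.opp c a hc hc')))
    rintro y ⟨h1, h2⟩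
    rcases lt_trichotomy (φ y a) (φ y c) with h | h | h
    · exact Or.inr (Or.inr ⟨h1, h, fun h3 => h2 ⟨_, c, a, hc, hc', h, h3⟩⟩)
    · exact Or.inl h
    · exact Or.inr (Or.inl ⟨h1, h, fun h3 => h2 ⟨_, a, c, ha, hc, h, h3⟩⟩)

/-- An improvement at the states satisfying `P` is inherited in proportion to the probability of
hitting such a state within `k` splits. -/
theorem mass_le_of_hitsIn (hR : IsRecurrentClass R D p) (hB : SplitInvariant B) {u : ℝ}
    (hu0 : 0 ≤ u) (hu : MassBound μ R B u) {P : Combinatorics d → (Fin d → ℝ) → Prop} {ε : ℝ}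
    (hP : ∀ π ∈ R, ∀ φ : V →ₗ[ℝ] (Fin d → ℝ), Parametrizes φ π → ∀ l : Fin d → ℝ,
      (∀ i, 0 < l i) → P π l → mass μ φ l (B π) ≤ (1 - ε) * u * mass μ φ l Set.univ)
    (hε : 0 ≤ ε) (k : ℕ) {π : Combinatorics d} (hπ : π ∈ R) {φ : V →ₗ[ℝ] (Fin d → ℝ)}
    (hφ : Parametrizes φ π) {l : Fin d → ℝ} (hl : ∀ i, 0 < l i) :
    mass μ φ l (B π) ≤ u * (mass μ φ l Set.univ - ε * mass μ φ l (HitsIn P k π l)) := by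
  -- If the condition already holds, every point hits at once. Otherwise the induction on `k`
  -- decomposes by the first split.
  by_cases h : P π l
  · have h1 : HitsIn P k π l = Set.univ := Set.eq_univ_of_forall fun x => mem_hitsIn_of h k x
    rw [h1]
    have := hP π hπ φ hφ l hl h
    linarith
  induction k generalizing π φ l with
  | zero =>
    have h1 : HitsIn P 0 π l = ∅ := Set.eq_empty_of_forall_notMem fun x hx => h hx
    have h2 : mass μ φ l ∅ = 0 := by simp [mass]
    rw [h1, h2]
    have := hu π hπ φ hφ l hl
    linarith
  | succ k ih =>
    have key : ∀ s a c, π.crit s = some a → π.crit s.opp = some c →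
        mass μ (subWidth a c ∘ₗ φ) (addWeight a c l) (B (π.split s)) ≤
          u * (mass μ (subWidth a c ∘ₗ φ) (addWeight a c l) Set.univ -
            ε * mass μ (subWidth a c ∘ₗ φ) (addWeight a c l)
              (HitsIn P k (π.split s) (addWeight a c l))) := by
      intro s a c ha hc
      have hac := hR.ne_of_crit hπ ha hc
      rcases canSplit_or_mass_eq_zero μ ha hc hac hφ l with hs | hs
      · by_cases hP' : P (π.split s) (addWeight a c l)
        · have h1 : HitsIn P k (π.split s) (addWeight a c l) = Set.univ :=
            Set.eq_univ_of_forall fun x => mem_hitsIn_of hP' k x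
          rw [h1]
          have := hP _ (hR.closed π hπ s hs) _ (hφ.split ha hc hac) _ (addWeight_pos a c hl) hP'
          linarith
        · exact ih (hR.closed π hπ s hs) (hφ.split ha hc hac) (addWeight_pos a c hl) hP'
      · rw [hs, hs, hs]; simp
    obtain ⟨a, c, -, ha, hc, -⟩ := hR.exists_crit hπ .top
    have hc' : π.crit Side.top.opp.opp = some a := ha
    have hac := hR.ne_of_crit hπ ha hc
    have h0 := hR.measure_coincidence_eq_zero μ hπ ha hc hφ
    have h1 := mass_le_split_add_split μ hφ.injective hl hac h0 (A := B π)
      (fun x hx _ hlt => hB π .top a c x ha hc hlt hx)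
      (fun x hx _ hlt => hB π Side.top.opp c a x hc hc' hlt hx)
    have h2 := mass_le_split_add_split μ hφ.injective hl hac h0 (A := HitsIn P (k + 1) π l)
      (A₁ := HitsIn P k (π.split .top) (addWeight a c l))
      (A₂ := HitsIn P k (π.split Side.top.opp) (addWeight c a l)) ?_ ?_
    · have h3 := key .top a c ha hc
      have h4 := key Side.top.opp c a hc hc'
      have h5 := mass_split_add_split_le μ hφ.injective hl hac
      have h6 := mul_le_mul_of_nonneg_left h5 hu0
      have h7 := mul_le_mul_of_nonneg_left h2 (mul_nonneg hu0 hε)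
      linarith
    · rintro x (hx | ⟨s', a', c', ha', hc'', hlt', hx⟩) - hlt
      · exact absurd hx h
      · obtain ⟨rfl, rfl, rfl⟩ := split_unique ha hc hlt ha' hc'' hlt'
        exact hx
    · rintro x (hx | ⟨s', a', c', ha', hc'', hlt', hx⟩) - hlt
      · exact absurd hx h
      · obtain ⟨rfl, rfl, rfl⟩ := split_unique hc hc' hlt ha' hc'' hlt'
        exact hx

/-- The hitting sets increase with `k`, so continuity of measure allows an unbounded hitting time,
and the widths with finite expansion are negligible. -/
theorem mass_le_of_hits (hR : IsRecurrentClass R D p) (hB : SplitInvariant B) {u : ℝ}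
    (hu0 : 0 ≤ u) (hu : MassBound μ R B u) {P : Combinatorics d → (Fin d → ℝ) → Prop} {ε : ℝ}
    (hP : ∀ π ∈ R, ∀ φ : V →ₗ[ℝ] (Fin d → ℝ), Parametrizes φ π → ∀ l : Fin d → ℝ,
      (∀ i, 0 < l i) → P π l → mass μ φ l (B π) ≤ (1 - ε) * u * mass μ φ l Set.univ)
    (hε : 0 ≤ ε) {π : Combinatorics d} (hπ : π ∈ R) {φ : V →ₗ[ℝ] (Fin d → ℝ)}
    (hφ : Parametrizes φ π) {l : Fin d → ℝ} (hl : ∀ i, 0 < l i) {G : Set (Fin d → ℝ)}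
    (hG : ∀ x ∈ G, x ∈ wedge l → π.Switch x → (∀ k, Survives k π x) → ∃ k, x ∈ HitsIn P k π l) :
    mass μ φ l (B π) ≤ u * (mass μ φ l Set.univ - ε * mass μ φ l G) := by
  set H : ℕ → Set V := fun k => {y | φ y ∈ wedge l ∧ φ y ∈ HitsIn P k π l} with hH
  have hmono : Monotone H :=
    monotone_nat_of_le_succ fun k y hy => ⟨hy.1, hitsIn_subset_succ P k π l hy.2⟩
  have hfin : μ (⋃ k, H k) ≠ ⊤ :=
    ((measure_mono (Set.iUnion_subset fun k y hy => hy.1)).trans_lt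
      (measure_wedge_lt_top μ hφ.injective hl)).ne
  have hlim : Filter.Tendsto (fun k => mass μ φ l (HitsIn P k π l)) Filter.atTop
      (nhds (μ.real (⋃ k, H k))) :=
    (ENNReal.tendsto_toReal hfin).comp (tendsto_measure_iUnion_atTop hmono)
  have h1 : mass μ φ l (B π) ≤ u * (mass μ φ l Set.univ - ε * μ.real (⋃ k, H k)) :=
    ge_of_tendsto' ((tendsto_const_nhds.sub (hlim.const_mul ε)).const_mul u)
      fun k => hR.mass_le_of_hitsIn μ hB hu0 hu hP hε k hπ hφ hl
  have hN : μ (⋃ k, {y | (∀ i, 0 < φ y i) ∧ ¬Survives k π (φ y)}) = 0 :=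
    measure_iUnion_null fun k => hR.measure_not_survives μ k hπ hφ
  have h2 : mass μ φ l G ≤ μ.real (⋃ k, H k) := by
    have hsub : {y | φ y ∈ wedge l ∧ φ y ∈ G} ⊆
        (⋃ k, {y | (∀ i, 0 < φ y i) ∧ ¬Survives k π (φ y)}) ∪ ⋃ k, H k := by
      rintro y ⟨hy, hyG⟩
      by_cases hs : ∀ k, Survives k π (φ y)
      · obtain ⟨k, hk⟩ := hG _ hyG hy ((hφ.mem_range _).1 ⟨y, rfl⟩) hs
        exact Or.inr (Set.mem_iUnion.2 ⟨k, hy, hk⟩)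
      · push Not at hs
        obtain ⟨k, hk⟩ := hs
        exact Or.inl (Set.mem_iUnion.2 ⟨k, hy.1, hk⟩)
    refine (measureReal_mono hsub (measure_union_ne_top (by rw [hN]; simp) hfin)).trans
      ((measureReal_union_le _ _).trans ?_)
    rw [measureReal_def μ (⋃ k, {y | (∀ i, 0 < φ y i) ∧ ¬Survives k π (φ y)}), hN]
    simp
  have h3 := mul_le_mul_of_nonneg_left h2 (mul_nonneg hu0 hε)
  linarith

/-- While only the light labels `S` win, their widths decrease or their weights increase, so that
one of them has to become heavy. -/
theorem mem_hitsIn_of_light_crit (hR : IsRecurrentClass R D p) {S : Finset (Fin d)}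
    {θ ξ η : ℝ} (hθ : 0 < θ) (hξ : 0 < ξ) (hη : 0 < η) (k : ℕ)
    {π : Combinatorics d} (hπ : π ∈ R) {l x : Fin d → ℝ} (hl : ∀ i, 0 < l i) (hx : x ∈ wedge l)
    (hsw : π.Switch x) (hN : ∀ i ∉ D, i ∉ S → ξ < x i ∧ θ ≤ l i)
    (hS : ∀ i ∈ S, η ≤ l i ∧ l i < θ) (hcrit : ∃ s, ∃ a ∈ S, π.crit s = some a)
    (hsurv : Survives k π x)
    (hpot : (∑ i ∈ S, x i) / ξ - (∑ i ∈ S, l i) / η < k - S.card * θ / η) :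
    x ∈ HitsIn (fun _ l => (∀ i ∉ D, l i ≤ 2 * θ + 1 / ξ) ∧
      (Finset.univ.filter fun i => i ∉ D ∧ l i < θ).card < S.card) k π l := by
  induction k generalizing π l x with
  | zero =>
    exfalso
    -- The potential is never below `-(S.card * θ / η)`, so no budget of splits can be exhausted
    -- before a hit.
    have h1 : 0 ≤ (∑ i ∈ S, x i) / ξ := div_nonneg (Finset.sum_nonneg fun i _ => (hx.1 i).le) hξ.le
    have h2 : ∑ i ∈ S, l i ≤ S.card * θ := by
      rw [← nsmul_eq_mul]
      exact Finset.sum_le_card_nsmul _ _ _ fun i hi => (hS i hi).2.le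
    have h3 : (∑ i ∈ S, l i) / η ≤ S.card * θ / η := div_le_div_of_nonneg_right h2 hη.le
    push_cast at hpot
    linarith
  | succ k ih =>
    obtain ⟨s, a, c, ha, hc, hlt, hsurv'⟩ := hsurv
    refine Or.inr ⟨s, a, c, ha, hc, hlt, ?_⟩
    have hac := hR.ne_of_crit hπ ha hc
    have haD := hR.crit_notMem π hπ _ _ ha
    have hcD := hR.crit_notMem π hπ _ _ hc
    have hR' : π.split s ∈ R := hR.closed π hπ s ⟨a, c, x, ha, hc, hx.1, hsw, hlt⟩
    -- Heavy weights are controlled through `l i * x i ≤ 1`. Before a hit heavy labels never win, so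
    -- their widths remain above `ξ`.
    have hlb : ∀ i ∉ D, i ∉ S → l i ≤ 1 / ξ := by
      intro i hi hiS
      rw [le_div_iff₀ hξ]
      have h1 := mul_le_one_of_mem_wedge hl hx i
      have h2 := mul_le_mul_of_nonneg_left (hN i hi hiS).1.le (hl i).le
      linarith
    have hξ' : 0 < 1 / ξ := by positivity
    -- In the first case the light loser becomes heavy, which is the hit.
    by_cases hhit : c ∈ S ∧ θ ≤ l c + l a
    · obtain ⟨hcS, hge⟩ := hhit
      refine mem_hitsIn_of ⟨fun i hi => ?_, ?_⟩ _ _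
      · rw [addWeight_apply]
        split_ifs with hic
        · have h1 := (hS c hcS).2
          by_cases haS : a ∈ S
          · linarith [(hS a haS).2]
          · linarith [hlb a haD haS]
        · by_cases hiS : i ∈ S
          · linarith [(hS i hiS).2]
          · linarith [hlb i hi hiS]
      · refine lt_of_le_of_lt (Finset.card_le_card ?_) (Finset.card_erase_lt_of_mem hcS)
        intro i hi
        simp only [Finset.mem_filter, Finset.mem_univ, true_and, addWeight_apply] at hi
        obtain ⟨hiD, hi⟩ := hi
        split_ifs at hi with hic
        · linarith
        · refine Finset.mem_erase.2 ⟨hic, ?_⟩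
          by_contra hiS
          linarith [(hN i hiD hiS).2]
    · have haS : a ∈ S := by
        by_contra haS
        have hcS : c ∈ S := by
          obtain ⟨t, b, hb, htb⟩ := hcrit
          rcases Side.eq_or_eq_opp s t with rfl | rfl
          · rw [ha] at htb; cases htb; exact absurd hb haS
          · rw [hc] at htb; cases htb; exact hb
        exact hhit ⟨hcS, by linarith [(hN a haD haS).2, hl c]⟩
      have hxs : ∑ i ∈ S, subWidth a c x i = ∑ i ∈ S, x i - x c := by
        rw [← Finset.add_sum_erase _ _ haS, ← Finset.add_sum_erase S x haS, subWidth_apply,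
          if_pos rfl, Finset.sum_congr rfl fun i hi => by
            rw [subWidth_apply, if_neg (Finset.ne_of_mem_erase hi)]]
        ring
      refine ih hR' (addWeight_pos a c hl) ((subWidth_mem_wedge_iff hac).2 ⟨hx, hlt⟩) ?_ ?_ ?_
        ⟨s, a, haS, Combinatorics.crit_split_self π s ha hc⟩ hsurv' ?_
      · rw [Combinatorics.switch_iff _ s, Combinatorics.sw_split π s ha hc hac,
          ← Combinatorics.switch_iff]
        exact hsw
      · intro i hi hiS
        have hia : i ≠ a := by rintro rfl; exact hiS haS
        rw [subWidth_apply, if_neg hia]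
        exact ⟨(hN i hi hiS).1, (hN i hi hiS).2.trans (le_addWeight a c hl i)⟩
      · intro i hi
        refine ⟨(hS i hi).1.trans (le_addWeight a c hl i), ?_⟩
        rw [addWeight_apply]
        split_ifs with hic
        · subst hic
          by_contra hcon
          exact hhit ⟨hi, not_lt.1 hcon⟩
        · exact (hS i hi).2
      · rw [hxs]
        push_cast at hpot
        -- The potential drops by at least one: a light loser gains the weight `l a ≥ η`, and a
        -- heavy loser takes the width `x c > ξ` away from a light label.
        by_cases hcS : c ∈ S
        · have hls : ∑ i ∈ S, addWeight a c l i = ∑ i ∈ S, l i + l a := by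
            rw [← Finset.add_sum_erase _ _ hcS, ← Finset.add_sum_erase S l hcS, addWeight_apply,
              if_pos rfl, Finset.sum_congr rfl fun i hi => by
                rw [addWeight_apply, if_neg (Finset.ne_of_mem_erase hi)]]
            ring
          rw [hls, sub_div, add_div]
          have h1 : 0 ≤ x c / ξ := div_nonneg (hx.1 c).le hξ.le
          have h2 : 1 ≤ l a / η := (one_le_div hη).2 (hS a haS).1
          linarith
        · have hls : ∑ i ∈ S, addWeight a c l i = ∑ i ∈ S, l i :=
            Finset.sum_congr rfl fun i hi => by
              rw [addWeight_apply, if_neg (by rintro rfl; exact hcS hi)]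
          rw [hls, sub_div]
          have h1 : 1 ≤ x c / ξ := (one_le_div hξ).2 (hN c hcD hcS).1.le
          linarith

/-- Union bound over the at most `d` labels outside `D`, each narrow with proportion at most `ε * 3
^ finrank`. -/
theorem half_mass_le (hR : IsRecurrentClass R D p) {π : Combinatorics d} (hπ : π ∈ R)
    {φ : V →ₗ[ℝ] (Fin d → ℝ)} (hφ : Parametrizes φ π) {l : Fin d → ℝ} (hl : ∀ i, 0 < l i)
    {M ε : ℝ} (hε : 0 < ε) (hε' : d * (ε * 3 ^ Module.finrank ℝ V) ≤ 1 / 2)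
    (hM : ∀ i ∉ D, l i ≤ M) :
    1 / 2 * mass μ φ l Set.univ ≤ mass μ φ l {x | ∀ i ∉ D, ε / M < x i} := by
  have hsub : {y | φ y ∈ wedge l ∧ φ y ∈ Set.univ} ⊆
      {y | φ y ∈ wedge l ∧ φ y ∈ {x | ∀ i ∉ D, ε / M < x i}} ∪
        ⋃ i ∈ Dᶜ, {y | φ y ∈ wedge l ∧ φ y ∈ {x | x i ≤ ε / M}} := by
    rintro y ⟨hy, -⟩
    by_cases h : ∀ i ∉ D, ε / M < φ y i
    · exact Or.inl ⟨hy, h⟩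
    · push Not at h
      obtain ⟨i, hi, hle⟩ := h
      exact Or.inr (Set.mem_iUnion₂.2 ⟨i, Finset.mem_compl.2 hi, hy, hle⟩)
  have h1 : mass μ φ l Set.univ ≤ mass μ φ l {x | ∀ i ∉ D, ε / M < x i} +
      ∑ i ∈ Dᶜ, mass μ φ l {x | x i ≤ ε / M} := by
    refine (measureReal_mono hsub (((measure_mono (Set.union_subset (fun y hy => hy.1)
      (Set.iUnion₂_subset fun i _ y hy => hy.1))).trans_lt
        (measure_wedge_lt_top μ hφ.injective hl)).ne)).trans ((measureReal_union_le _ _).trans ?_)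
    exact add_le_add le_rfl (measureReal_biUnion_finset_le _ _)
  have h2 : ∑ i ∈ Dᶜ, mass μ φ l {x | x i ≤ ε / M} ≤
      d * (ε * 3 ^ Module.finrank ℝ V) * mass μ φ l Set.univ := by
    have hm := mass_nonneg μ φ l Set.univ
    calc ∑ i ∈ Dᶜ, mass μ φ l {x | x i ≤ ε / M}
        ≤ Dᶜ.card • (ε * 3 ^ Module.finrank ℝ V * mass μ φ l Set.univ) :=
          Finset.sum_le_card_nsmul _ _ _ fun i hi =>
            hR.mass_narrow_le μ hπ hφ hl hε hM (Finset.mem_compl.1 hi)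
      _ = Dᶜ.card * (ε * 3 ^ Module.finrank ℝ V) * mass μ φ l Set.univ := by
          rw [nsmul_eq_mul]; ring
      _ ≤ _ := by
          gcongr
          exact (Finset.card_le_univ _).trans (by simp)
  have h3 := mul_le_mul_of_nonneg_right hε' (mass_nonneg μ φ l Set.univ)
  linarith

/-- If a light label is critical, then with definite probability the number of light labels
decreases while the weights remain under control. -/
theorem improves_of_light_crit (hR : IsRecurrentClass R D p) (hB : SplitInvariant B) (j : ℕ)
    (ih : ∀ C, 1 ≤ C → Improves μ R B B fun _ l => ∃ M, (∀ i ∉ D, l i ≤ M) ∧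
      (light D C M l).card ≤ j) (C : ℝ) (hC : 1 ≤ C) :
    Improves μ R B B fun π l => ∃ M, (∀ i ∉ D, l i ≤ M) ∧ (light D C M l).card ≤ j + 1 ∧
      ∃ s, ∃ a ∈ light D C M l, π.crit s = some a := by
  obtain ⟨ε, hε, hε'⟩ : ∃ ε : ℝ, 0 < ε ∧ d * (ε * 3 ^ Module.finrank ℝ V) ≤ 1 / 2 := by
    refine ⟨1 / (2 * (d + 1) * 3 ^ Module.finrank ℝ V), by positivity, ?_⟩
    have h3 : (3 : ℝ) ^ Module.finrank ℝ V ≠ 0 := by positivity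
    field_simp
    linarith
  have hCε : 0 < C / ε := by positivity
  -- With `θ = M / C` and `ξ = ε / M`, the new bound on the weights is `2 θ + 1 / ξ = (2 + C / ε) *
  -- θ`. With this constant the threshold for being light is again `θ`.
  obtain ⟨ε₁, h1, h1', hε₁⟩ := ih (2 + C / ε) (by linarith)
  refine ⟨ε₁ * (1 / 2), by positivity, by linarith, ?_⟩
  rintro u hu0 hu π hπ φ hφ l hl ⟨M, hM, hcard, s₀, a₀, ha₀, hcrit⟩
  have hM0 : 0 < M := (hl a₀).trans_le (hM a₀ (mem_light.1 ha₀).1)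
  have hC0 : 0 < C := by linarith
  set S := light D C M l with hS
  have hSne : S.Nonempty := ⟨a₀, ha₀⟩
  obtain ⟨i₀, hi₀, hmin⟩ := S.exists_min_image l hSne
  have key := hR.mass_le_of_hits μ hB hu0 hu (ε := ε₁)
    (P := fun _ l' => (∀ i ∉ D, l' i ≤ 2 * (M / C) + 1 / (ε / M)) ∧
      (Finset.univ.filter fun i => i ∉ D ∧ l' i < M / C).card < S.card) ?_ h1.le hπ hφ hl
    (G := {x | ∀ i ∉ D, ε / M < x i}) ?_
  · have h2 := hR.half_mass_le μ hπ hφ hl hε hε' hM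
    have h3 := mul_le_mul_of_nonneg_left h2 (mul_nonneg hu0 h1.le)
    linarith
  · rintro π' hπ' φ' hφ' l' hl' ⟨hM', hcard'⟩
    refine hε₁ u hu0 hu π' hπ' φ' hφ' l' hl' ⟨_, hM', ?_⟩
    have hset : light D (2 + C / ε) (2 * (M / C) + 1 / (ε / M)) l' =
        Finset.univ.filter fun i => i ∉ D ∧ l' i < M / C := by
      have e : 2 * (M / C) + 1 / (ε / M) = (2 + C / ε) * (M / C) := by field_simp
      ext i
      rw [mem_light, e]
      simp only [Finset.mem_filter, Finset.mem_univ, true_and]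
      rw [mul_lt_mul_iff_right₀ (by positivity)]
    rw [hset]
    omega
  · intro x hxG hx hsw hsurv
    -- The budget exceeds the initial potential minus its lower bound, with `η` the smallest light
    -- weight. It depends on the point and the weights, so only the probability is uniform, not the
    -- hitting time.
    obtain ⟨k, hk⟩ := exists_nat_gt ((∑ i ∈ S, x i) / (ε / M) - (∑ i ∈ S, l i) / l i₀ +
      S.card * (M / C) / l i₀)
    refine ⟨k, hR.mem_hitsIn_of_light_crit (by positivity)
      (by positivity) (hl i₀) k hπ hl hx hsw (fun i hi hiS => ⟨hxG i hi, ?_⟩)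
      (fun i hi => ⟨hmin i hi, ?_⟩) ⟨s₀, a₀, ha₀, hcrit⟩ (hsurv k) (by linarith)⟩
    · rw [div_le_iff₀ hC0, mul_comm]
      exact le_of_notMem_light hi hiS
    · rw [lt_div_iff₀ hC0, mul_comm]
      exact (mem_light.1 hi).2

theorem exists_attains_crit (hR : IsRecurrentClass R D p) :
    ∃ k, ∀ α ∉ D, ∀ π ∈ R, AttainsIn (fun π' => ∃ s, π'.crit s = some α) k π := by
  have h : ∀ α : Fin d, ∃ k, α ∉ D → ∀ π ∈ R,
      AttainsIn (fun π' => ∃ s, π'.crit s = some α) k π := by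
    intro α
    by_cases hα : α ∈ D
    · exact ⟨0, fun h => absurd hα h⟩
    · obtain ⟨k, hk⟩ := exists_uniform_attainsIn hR.finite (hR.attains_crit α hα)
      exact ⟨k, fun _ => hk⟩
  choose k hk using h
  exact ⟨Finset.univ.sup k, fun α hα π hπ =>
    (hk α hα π hπ).mono (Finset.le_sup (Finset.mem_univ α))⟩

/-- Induction on the number of light labels. With none, a path is followed to `p`. Otherwise a path
is followed until a light label is critical, after which equalization lowers their number at the
cost of a larger comparability constant; this is why the bound is claimed for every `C`. -/
theorem improves_of_card_light_le (hR : IsRecurrentClass R D p) (hB : SplitInvariant B)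
    (hbase : ∀ C, 1 ≤ C → Improves μ R B B fun π l => ∃ M, (∀ i ∉ D, l i ≤ M) ∧
      light D C M l = ∅ ∧ (⟦π⟧ : ReducedType d) = p) (j : ℕ) :
    ∀ C, 1 ≤ C → Improves μ R B B fun _ l => ∃ M, (∀ i ∉ D, l i ≤ M) ∧
      (light D C M l).card ≤ j := by
  induction j with
  | zero =>
    intro C hC
    obtain ⟨k, hk⟩ := exists_uniform_attainsIn hR.finite hR.attains_vertex
    obtain ⟨ε, h0, h1, h⟩ := hR.improves_of_path μ hB 0
      (fun _ π => (⟦π⟧ : ReducedType d) = p) (fun π _ S hS _ s a _ => by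
        rw [Finset.card_eq_zero.1 (Nat.le_zero.1 hS)]; simp) (fun C hC => by
        obtain ⟨ε, h0, h1, h⟩ := hbase C hC
        refine ⟨ε, h0, h1, ?_⟩
        rintro u hu0 hu π hπ φ hφ l hl ⟨M, hM, hcard, hQ⟩
        exact h u hu0 hu π hπ φ hφ l hl
          ⟨M, hM, Finset.card_eq_zero.1 (Nat.le_zero.1 hcard), hQ⟩) k C hC
    refine ⟨ε, h0, h1, ?_⟩
    rintro u hu0 hu π hπ φ hφ l hl ⟨M, hM, hcard⟩
    exact h u hu0 hu π hπ φ hφ l hl ⟨M, hM, hcard, hk π hπ⟩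
  | succ j ih =>
    intro C hC
    obtain ⟨k, hk⟩ := hR.exists_attains_crit
    obtain ⟨ε₀, h0, h0', hε₀⟩ := ih C hC
    obtain ⟨ε₁, h1, h1', hε₁⟩ := hR.improves_of_path μ hB (j + 1)
      (fun S π => ∃ s, ∃ a ∈ S, π.crit s = some a)
      (fun π _ S _ hQ s a ha haS => hQ ⟨s, a, haS, ha⟩)
      (hR.improves_of_light_crit μ hB j ih) k C hC
    refine ⟨min ε₀ ε₁, lt_min h0 h1, (min_le_left _ _).trans h0', ?_⟩
    rintro u hu0 hu π hπ φ hφ l hl ⟨M, hM, hcard⟩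
    have hm : 0 ≤ u * mass μ φ l Set.univ := mul_nonneg hu0 (mass_nonneg _ _ _ _)
    by_cases hj : (light D C M l).card ≤ j
    · have := hε₀ u hu0 hu π hπ φ hφ l hl ⟨M, hM, hj⟩
      have h2 := mul_le_mul_of_nonneg_right (min_le_left ε₀ ε₁) hm
      linarith
    · obtain ⟨α, hα⟩ : (light D C M l).Nonempty := Finset.card_pos.1 (by omega)
      have := hε₁ u hu0 hu π hπ φ hφ l hl ⟨M, hM, hcard,
        (hk α (mem_light.1 hα).1 π hπ).mono_target fun π' ⟨s, hs⟩ => ⟨s, α, hα, hs⟩⟩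
      have h2 := mul_le_mul_of_nonneg_right (min_le_right ε₀ ε₁) hm
      linarith

/-- If the family `B` occupies a definitely smaller proportion at balanced states of type `p`, then
it is negligible. -/
theorem mass_eq_zero (hR : IsRecurrentClass R D p) (hB : SplitInvariant B)
    (hbase : ∀ C, 1 ≤ C → Improves μ R B B fun π l => ∃ M, (∀ i ∉ D, l i ≤ M) ∧
      light D C M l = ∅ ∧ (⟦π⟧ : ReducedType d) = p) {π : Combinatorics d} (hπ : π ∈ R)
    {φ : V →ₗ[ℝ] (Fin d → ℝ)} (hφ : Parametrizes φ π) {l : Fin d → ℝ} (hl : ∀ i, 0 < l i) :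
    mass μ φ l (B π) = 0 := by
  -- With `d` light labels allowed, every state qualifies, so the same factor `1 - ε` can be gained
  -- repeatedly.
  obtain ⟨ε, h0, h1, h⟩ := hR.improves_of_card_light_le μ hB hbase d 1 le_rfl
  have hstep : ∀ n : ℕ, MassBound μ R B ((1 - ε) ^ n) := by
    intro n
    induction n with
    | zero =>
      intro π hπ φ hφ l hl
      rw [pow_zero, one_mul]
      exact mass_le_univ μ hφ.injective hl _
    | succ n ih =>
      intro π hπ φ hφ l hl
      rw [pow_succ']
      refine h _ (pow_nonneg (by linarith) n) ih π hπ φ hφ l hl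
        ⟨∑ i, l i, fun i _ => Finset.single_le_sum (fun j _ => (hl j).le) (Finset.mem_univ i), ?_⟩
      exact (Finset.card_le_univ _).trans (by simp)
  have hlim : Filter.Tendsto (fun n : ℕ => (1 - ε) ^ n * mass μ φ l Set.univ) Filter.atTop
      (nhds (0 * mass μ φ l Set.univ)) :=
    (tendsto_pow_atTop_nhds_zero_of_lt_one (by linarith) (by linarith)).mul_const _
  rw [zero_mul] at hlim
  exact le_antisymm (ge_of_tendsto' hlim fun n => hstep n π hπ φ hφ l hl) (mass_nonneg _ _ _ _)

end IsRecurrentClass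

end Hitting

end NonclassicalIET

namespace NonclassicalIET

variable {d : ℕ}

/-! ### Labelled types versus the reduced diagram. -/

section Relabel

namespace Combinatorics

theorem word_relabel (σ : Equiv.Perm (Fin d)) (π : Combinatorics d) (s : Side) :
    (π.relabel σ).word s = (π.word s).map σ := by cases s <;> rfl

theorem crit_relabel (σ : Equiv.Perm (Fin d)) (π : Combinatorics d) (s : Side) :
    (π.relabel σ).crit s = (π.crit s).map σ := by
  rw [crit, word_relabel, List.getLast?_map, crit]

theorem flatMap_map_ite_left (σ : Equiv.Perm (Fin d)) (w : List (Fin d)) (a c : Fin d) :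
    (w.map σ).flatMap (fun x => if x = σ a then [σ c, x] else [x]) =
      (w.flatMap fun x => if x = a then [c, x] else [x]).map σ := by
  induction w with
  | nil => rfl
  | cons b w ih =>
    rw [List.map_cons, List.flatMap_cons, ih, List.flatMap_cons, List.map_append]
    by_cases h : b = a <;> simp [h]

theorem flatMap_map_ite_right (σ : Equiv.Perm (Fin d)) (w : List (Fin d)) (a c : Fin d) :
    (w.map σ).flatMap (fun x => if x = σ a then [x, σ c] else [x]) =
      (w.flatMap fun x => if x = a then [x, c] else [x]).map σ := by
  induction w with
  | nil => rfl
  | cons b w ih =>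
    rw [List.map_cons, List.flatMap_cons, ih, List.flatMap_cons, List.map_append]
    by_cases h : b = a <;> simp [h]

theorem ext_word {π π' : Combinatorics d} (s : Side) (h : π.word s = π'.word s)
    (h' : π.word s.opp = π'.word s.opp) : π = π' := by
  cases s
  · exact Combinatorics.ext h h'
  · exact Combinatorics.ext h' h

theorem split_relabel (σ : Equiv.Perm (Fin d)) {π : Combinatorics d} {s : Side} {a c : Fin d}
    (ha : π.crit s = some a) (hc : π.crit s.opp = some c) :
    (π.relabel σ).split s = (π.split s).relabel σ := by
  have ha' : (π.relabel σ).crit s = some (σ a) := by rw [crit_relabel, ha]; rfl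
  have hc' : (π.relabel σ).crit s.opp = some (σ c) := by rw [crit_relabel, hc]; rfl
  apply ext_word s
  · rw [word_split_self _ s ha' hc', word_relabel, word_relabel, word_split_self π s ha hc,
      List.map_append, ← List.map_dropLast, flatMap_map_ite_left]
    rfl
  · rw [word_split_opp _ s ha' hc', word_relabel, word_relabel, word_split_opp π s ha hc,
      ← List.map_dropLast, flatMap_map_ite_right]

theorem relabel_mul (σ τ : Equiv.Perm (Fin d)) (π : Combinatorics d) :
    π.relabel (σ * τ) = (π.relabel τ).relabel σ := by
  ext1 <;> simp [relabel, Function.comp_def]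

theorem relabel_one (π : Combinatorics d) : π.relabel 1 = π := by
  ext1 <;> simp [relabel]

theorem switch_relabel (σ : Equiv.Perm (Fin d)) (π : Combinatorics d) (x : Fin d → ℝ) :
    (π.relabel σ).Switch (x ∘ σ.symm) ↔ π.Switch x := by
  simp [Switch, relabel, Function.comp_def]

theorem IsLabelled.relabel {π : Combinatorics d} (h : π.IsLabelled) (σ : Equiv.Perm (Fin d)) :
    (π.relabel σ).IsLabelled := by
  intro α
  obtain ⟨β, rfl⟩ := σ.surjective α
  rw [Combinatorics.relabel, List.count_map_of_injective _ _ σ.injective,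
    List.count_map_of_injective _ _ σ.injective]
  exact h β

theorem exists_relabel_of_eq {π π' : Combinatorics d}
    (h : (⟦π⟧ : ReducedType d) = ⟦π'⟧) : ∃ σ : Equiv.Perm (Fin d), π.relabel σ = π' :=
  Quotient.exact h

theorem mk_relabel (σ : Equiv.Perm (Fin d)) (π : Combinatorics d) :
    (⟦π.relabel σ⟧ : ReducedType d) = ⟦π⟧ :=
  (Quotient.sound ⟨σ, rfl⟩ : (⟦π⟧ : ReducedType d) = ⟦π.relabel σ⟧).symm

theorem finite_isLabelled (d : ℕ) : {π : Combinatorics d | π.IsLabelled}.Finite := by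
  have hlen : ∀ w : List (Fin d), (∀ α, w.count α ≤ 2) → w.length ≤ 2 * d := by
    intro w hw
    have h1 : ∑ α, w.count α = w.length := by
      have := Multiset.sum_count_eq_card (s := Finset.univ) (m := (w : Multiset (Fin d)))
        (fun a _ => Finset.mem_univ a)
      simpa using this
    rw [← h1]
    calc ∑ α, w.count α ≤ ∑ _α : Fin d, 2 := Finset.sum_le_sum fun α _ => hw α
      _ = 2 * d := by simp [mul_comm]
  have hfin : ({w : List (Fin d) | w.length ≤ 2 * d} ×ˢ {w : List (Fin d) | w.length ≤ 2 * d}).Finite :=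
    (List.finite_length_le _ _).prod (List.finite_length_le _ _)
  refine (hfin.image fun w => (⟨w.1, w.2⟩ : Combinatorics d)).subset ?_
  intro π hπ
  refine ⟨(π.top, π.bot), ⟨hlen _ fun α => ?_, hlen _ fun α => ?_⟩, rfl⟩ <;>
  · have h := hπ α
    dsimp only
    omega

end Combinatorics

theorem CanSplit.relabel {π : Combinatorics d} {s : Side} (h : CanSplit π s)
    (σ : Equiv.Perm (Fin d)) : CanSplit (π.relabel σ) s := by
  obtain ⟨a, c, x, ha, hc, hx, hsw, hlt⟩ := h
  refine ⟨σ a, σ c, x ∘ σ.symm, ?_, ?_, fun i => hx _, (Combinatorics.switch_relabel σ π x).2 hsw,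
    by simpa using hlt⟩
  · rw [Combinatorics.crit_relabel, ha]; rfl
  · rw [Combinatorics.crit_relabel, hc]; rfl

theorem CanSplit.split_relabel {π : Combinatorics d} {s : Side} (h : CanSplit π s)
    (σ : Equiv.Perm (Fin d)) : (π.relabel σ).split s = (π.split s).relabel σ := by
  obtain ⟨a, c, x, ha, hc, -⟩ := h
  exact Combinatorics.split_relabel σ ha hc

/-- An arrow asks for a non-classical representative of its source, while realizability of a split
only asks for widths; the representative `π₀` is therefore a separate datum. -/
theorem arrow_of_canSplit {π π₀ : Combinatorics d} {s : Side} (h : CanSplit π s)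
    (h₀ : π₀.IsNonclassical) (he : (⟦π₀⟧ : ReducedType d) = ⟦π⟧) :
    Arrow s (⟦π⟧ : ReducedType d) ⟦π.split s⟧ := by
  obtain ⟨σ, rfl⟩ := Combinatorics.exists_relabel_of_eq he.symm
  obtain ⟨a, c, x, ha, hc, hx, hsw, hlt⟩ := h.relabel σ
  refine ⟨⟨π.relabel σ, x⟩, _, ⟨h₀, hx, hsw⟩, he, (Exchange.step_eq_some_iff _ _ _).2
    ⟨a, c, ha, hc, hlt, rfl⟩, ?_⟩
  change (⟦(π.relabel σ).split s⟧ : ReducedType d) = _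
  rw [h.split_relabel, Combinatorics.mk_relabel]

theorem Arrow.lift {π : Combinatorics d} {s : Side} {q : ReducedType d}
    (h : Arrow s (⟦π⟧ : ReducedType d) q) :
    CanSplit π s ∧ (⟦π.split s⟧ : ReducedType d) = q ∧ π.IsLabelled ∧
      ∃ π₀ : Combinatorics d, π₀.IsNonclassical ∧ (⟦π₀⟧ : ReducedType d) = ⟦π⟧ := by
  obtain ⟨T, T', hT, htype, hstep, rfl⟩ := h
  obtain ⟨a, c, ha, hc, hlt, rfl⟩ := (Exchange.step_eq_some_iff _ _ _).1 hstep
  obtain ⟨σ, rfl⟩ := Combinatorics.exists_relabel_of_eq htype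
  have hs : CanSplit T.comb s := ⟨a, c, T.width, ha, hc, hT.pos, hT.switch, hlt⟩
  refine ⟨hs.relabel σ, ?_, hT.comb.labelled.relabel σ, T.comb, hT.comb, htype⟩
  rw [hs.split_relabel, Combinatorics.mk_relabel]
  rfl

end Relabel

/-! ### Recurrence of labelled paths above a sink. -/

section Graph

/-- One realized split between labelled types. -/
def LabelledStep (π π' : Combinatorics d) : Prop := ∃ s, CanSplit π s ∧ π.split s = π'

theorem exists_labelled_path {π : Combinatorics d} {q : ReducedType d}
    (h : Reaches (⟦π⟧ : ReducedType d) q) :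
    ∃ π', Relation.ReflTransGen LabelledStep π π' ∧ (⟦π'⟧ : ReducedType d) = q := by
  induction h with
  | refl => exact ⟨π, .refl, rfl⟩
  | tail _ hs ih =>
    obtain ⟨π', h1, rfl⟩ := ih
    obtain ⟨s, hs⟩ := hs
    obtain ⟨h2, h3, -⟩ := hs.lift
    exact ⟨_, h1.tail ⟨s, h2, rfl⟩, h3⟩

theorem labelled_path_relabel {π π' : Combinatorics d} (σ : Equiv.Perm (Fin d))
    (h : Relation.ReflTransGen LabelledStep π π') :
    Relation.ReflTransGen LabelledStep (π.relabel σ) (π'.relabel σ) := by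
  induction h with
  | refl => exact .refl
  | tail _ hs ih =>
    obtain ⟨s, hs, rfl⟩ := hs
    exact ih.tail ⟨s, hs.relabel σ, hs.split_relabel σ⟩

theorem labelled_path_relabel_symm {π : Combinatorics d} {σ : Equiv.Perm (Fin d)}
    (h : Relation.ReflTransGen LabelledStep π (π.relabel σ)) :
    Relation.ReflTransGen LabelledStep (π.relabel σ) π := by
  -- Relabelled copies of the path are concatenated. As `σ` has finite order, they return to `π`.
  have hk : ∀ k : ℕ, Relation.ReflTransGen LabelledStep (π.relabel σ) (π.relabel (σ ^ (k + 1))) := by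
    intro k
    induction k with
    | zero => rw [zero_add, pow_one]
    | succ k ih =>
      have := labelled_path_relabel (σ ^ (k + 1)) h
      rw [← Combinatorics.relabel_mul, ← pow_succ] at this
      exact ih.trans this
  have h1 := hk (orderOf σ - 1)
  rwa [Nat.sub_add_cancel (orderOf_pos σ), pow_orderOf_eq_one, Combinatorics.relabel_one] at h1

theorem attainsIn_of_labelled_path {Q : Combinatorics d → Prop} {π π' : Combinatorics d}
    (h : Relation.ReflTransGen LabelledStep π π') (hQ : Q π') : ∃ k, AttainsIn Q k π := by
  induction h using Relation.ReflTransGen.head_induction_on with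
  | refl => exact ⟨0, hQ⟩
  | head hs _ ih =>
    obtain ⟨s, hs, rfl⟩ := hs
    obtain ⟨k, hk⟩ := ih
    exact ⟨k + 1, Or.inr ⟨s, hs, hk⟩⟩

/-- If a vertex of a sink has an outgoing arrow, then all vertices have one. -/
theorem exists_arrow_of_reaches {p₀ p q r : ReducedType d} {s : Side} (h₀ : NonTransient p₀)
    (hp : Reaches p₀ p) (hs : Arrow s p q) (hr : Reaches p₀ r) : ∃ s' q', Arrow s' r q' := by
  rcases Relation.ReflTransGen.cases_head ((h₀ r hr).trans hp) with rfl | ⟨q', ⟨s', h⟩, -⟩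
  · exact ⟨s, q, hs⟩
  · exact ⟨s', q', h⟩

/-- Preservation of non-classicality under splits is not needed: every vertex of a sink containing
an arrow has an outgoing arrow, and the source of an arrow has a non-classical representative. -/
theorem reaches_of_labelled_path {p₀ p q : ReducedType d} {s : Side} (h₀ : NonTransient p₀)
    (hp : Reaches p₀ p) (hs : Arrow s p q) {π π' : Combinatorics d} (hπ : Reaches p₀ ⟦π⟧)
    (h : Relation.ReflTransGen LabelledStep π π') : Reaches p₀ ⟦π'⟧ := by
  induction h with
  | refl => exact hπ
  | tail _ hstep ih =>
    obtain ⟨t, ht, rfl⟩ := hstep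
    obtain ⟨s', q', h'⟩ := exists_arrow_of_reaches h₀ hp hs ih
    obtain ⟨-, -, -, π₀, hπ₀, he⟩ := h'.lift
    exact ih.tail ⟨t, arrow_of_canSplit ht hπ₀ he⟩

end Graph

/-! ### Decoupling of the never critical labels from the others. -/

section Decoupling

theorem flatMap_ite_of_notMem {w : List (Fin d)} {a c : Fin d} (h : a ∉ w) :
    (w.flatMap fun x => if x = a then [x, c] else [x]) = w := by
  induction w with
  | nil => rfl
  | cons b w ih =>
    rw [List.mem_cons, not_or] at h
    rw [List.flatMap_cons, ih h.2, if_neg (Ne.symm h.1)]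
    rfl

variable {R : Set (Combinatorics d)}

/-- A critical label reversing orientation wins repeatedly until the other side carries a single
reversing label, which is then critical. -/
theorem exists_unique_opposite_reversing (hlab : ∀ π ∈ R, π.IsLabelled)
    (hsplit : ∀ π ∈ R, ∃ s, CanSplit π s) (hclosed : ∀ π ∈ R, ∀ s, CanSplit π s → π.split s ∈ R)
    {π : Combinatorics d} (hπ : π ∈ R) {s : Side} {a : Fin d} (ha : π.crit s = some a)
    (hpos : 0 < π.coef s a) :
    ∃ π' ∈ R, ∃ c, π'.crit s.opp = some c ∧ 0 < π'.coef s.opp c ∧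
      ∀ b, π'.coef s b < 0 → b = c := by
  induction hn : (π.word s.opp).length using Nat.strong_induction_on generalizing π with
  | _ n ih =>
    obtain ⟨t, a', c', x, ha', hc', hx, hsw, hlt⟩ := hsplit π hπ
    obtain ⟨c, hc, hac⟩ : ∃ c, π.crit s.opp = some c ∧ a ≠ c := by
      rcases Side.eq_or_eq_opp s t with rfl | rfl
      · rw [ha] at ha'; cases ha'
        exact ⟨c', hc', by rintro rfl; exact lt_irrefl _ hlt⟩
      · rw [Side.opp_opp, ha] at hc'; cases hc'
        exact ⟨a', ha', by rintro rfl; exact lt_irrefl _ hlt⟩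
    have htwo : π.coef s a = 2 := by
      rcases (hlab π hπ).coef_trichotomy s a with h | h | h <;> linarith
    by_cases hb : ∃ b, b ≠ c ∧ π.coef s b < 0
    · obtain ⟨b, hbc, hb⟩ := hb
      have hbtwo : π.coef s b = -2 := by
        rcases (hlab π hπ).coef_trichotomy s b with h | h | h <;> linarith
      -- Widening `a` and another reversing label `b` of the other side by `x c` preserves the
      -- switch condition and makes `a` win.
      have hs : CanSplit π s := by
        refine ⟨a, c, x + (Pi.single a (x c) + Pi.single b (x c)), ha, hc, fun i => ?_, ?_, ?_⟩
        · have h1 : 0 ≤ (Pi.single a (x c) : Fin d → ℝ) i := by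
            rw [Pi.single_apply]; split_ifs
            · exact (hx c).le
            · exact le_rfl
          have h2 : 0 ≤ (Pi.single b (x c) : Fin d → ℝ) i := by
            rw [Pi.single_apply]; split_ifs
            · exact (hx c).le
            · exact le_rfl
          simp only [Pi.add_apply]
          linarith [hx i]
        · rw [Combinatorics.switch_iff π s] at hsw ⊢
          rw [map_add, map_add, Combinatorics.sw_single, Combinatorics.sw_single, hsw, htwo, hbtwo]
          ring
        · have h2 : 0 ≤ (Pi.single b (x c) : Fin d → ℝ) a := by
            rw [Pi.single_apply]; split_ifs
            · exact (hx c).le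
            · exact le_rfl
          have h3 : (Pi.single b (x c) : Fin d → ℝ) c = 0 := by simp [Ne.symm hbc]
          have h4 : (Pi.single a (x c) : Fin d → ℝ) c = 0 := by simp [Ne.symm hac]
          simp only [Pi.add_apply, h3, h4, Pi.single_eq_same]
          linarith [hx a]
      -- As `a` has no end on the other side, the loser's end leaves that side and the word there
      -- gets shorter.
      have hnot : a ∉ π.word s.opp :=
        List.count_eq_zero.1 ((hlab π hπ).count_opp_eq_zero hpos)
      refine ih _ ?_ (hclosed π hπ s hs) (Combinatorics.crit_split_self π s ha hc) ?_ rfl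
      · rw [Combinatorics.word_split_opp π s ha hc,
          flatMap_ite_of_notMem fun h => hnot (List.mem_of_mem_dropLast h), List.length_dropLast,
          ← hn]
        have : 0 < (π.word s.opp).length := by
          rw [Combinatorics.word_eq_dropLast_append hc]; simp
        omega
      · rw [Combinatorics.coef_split π s ha hc hac, if_neg hac, add_zero]
        exact hpos
    · push Not at hb
      have huniq : ∀ b, π.coef s b < 0 → b = c := fun b hb' => by
        by_contra hne
        exact absurd hb' (not_lt.2 (hb b hne))
      obtain ⟨b, -, hb'⟩ := exists_coef_eq_neg (hlab π hπ) hx hsw hpos.ne' (X := ∅)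
        (by simpa using hx a) (by simp)
      have hbc := huniq b (by linarith)
      subst hbc
      exact ⟨π, hπ, b, hc, by rw [Combinatorics.coef_opp]; linarith, huniq⟩

/-- A coefficient changes only when its label loses, and then by the coefficient of the winner. -/
theorem coef_eq_of_labelled_path {π π' : Combinatorics d} (α : Fin d)
    (h : Relation.ReflTransGen LabelledStep π π')
    (hα : ∀ π'', Relation.ReflTransGen LabelledStep π π'' → ∀ s a c, π''.crit s = some a →
      π''.crit s.opp = some c → α = c → π''.coef s a = 0) (s : Side) :
    π'.coef s α = π.coef s α := by
  induction h with
  | refl => rfl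
  | @tail π₁ π₂ h1 hs ih =>
    obtain ⟨t, ⟨a, c, x, ha, hc, hx, hsw, hlt⟩, rfl⟩ := hs
    rw [← ih]
    have hac : a ≠ c := by rintro rfl; exact lt_irrefl _ hlt
    have key : (π₁.split t).coef t α = π₁.coef t α := by
      rw [Combinatorics.coef_split π₁ t ha hc hac]
      split_ifs with hαc
      · rw [hα π₁ h1 t a c ha hc hαc, add_zero]
      · rw [add_zero]
    rcases Side.eq_or_eq_opp t s with rfl | rfl
    · exact key
    · rw [Combinatorics.coef_opp, Combinatorics.coef_opp, key]

end Decoupling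

open Classical in
/-- The labels which are never critical on labelled types reached from `π`. -/
noncomputable def neverCritical (π : Combinatorics d) : Finset (Fin d) :=
  Finset.univ.filter fun α =>
    ∀ π', Relation.ReflTransGen LabelledStep π π' → ∀ s, π'.crit s ≠ some α

theorem mem_neverCritical {π : Combinatorics d} {α : Fin d} : α ∈ neverCritical π ↔
    ∀ π', Relation.ReflTransGen LabelledStep π π' → ∀ s, π'.crit s ≠ some α := by
  simp [neverCritical]

/-- The labelled types above a sink which are reached from a given one form a recurrent class. -/
theorem isRecurrentClass_of_nonTransient {p₀ p q : ReducedType d} {s : Side}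
    (h₀ : NonTransient p₀) (hp : Reaches p₀ p) (hs : Arrow s p q) {π₁ : Combinatorics d}
    (hπ₁ : Reaches p₀ ⟦π₁⟧) :
    IsRecurrentClass {π | Relation.ReflTransGen LabelledStep π₁ π} (neverCritical π₁) p := by
  have hreach : ∀ π, Relation.ReflTransGen LabelledStep π₁ π → Reaches p₀ ⟦π⟧ :=
    fun π hπ => reaches_of_labelled_path h₀ hp hs hπ₁ hπ
  have harrow : ∀ π, Relation.ReflTransGen LabelledStep π₁ π →
      (∃ s, CanSplit π s) ∧ π.IsLabelled := by
    intro π hπ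
    obtain ⟨s', q', h'⟩ := exists_arrow_of_reaches h₀ hp hs (hreach π hπ)
    obtain ⟨h1, -, h2, -⟩ := h'.lift
    exact ⟨⟨s', h1⟩, h2⟩
  -- The sink leads back to a relabelling of `π₁`, and finite order of the relabelling leads back to
  -- `π₁` itself.
  have hback : ∀ π, Relation.ReflTransGen LabelledStep π₁ π →
      Relation.ReflTransGen LabelledStep π π₁ := by
    intro π hπ
    obtain ⟨π₂, h1, h2⟩ := exists_labelled_path ((h₀ _ (hreach π hπ)).trans hπ₁)
    obtain ⟨σ, rfl⟩ := Combinatorics.exists_relabel_of_eq h2.symm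
    exact h1.trans (labelled_path_relabel_symm (hπ.trans h1))
  have hlab : ∀ π ∈ {π | Relation.ReflTransGen LabelledStep π₁ π}, π.IsLabelled :=
    fun π hπ => (harrow π hπ).2
  have hcan : ∀ π ∈ {π | Relation.ReflTransGen LabelledStep π₁ π}, ∃ s, CanSplit π s :=
    fun π hπ => (harrow π hπ).1
  have hcl : ∀ π ∈ {π | Relation.ReflTransGen LabelledStep π₁ π}, ∀ s, CanSplit π s →
      π.split s ∈ {π | Relation.ReflTransGen LabelledStep π₁ π} :=
    fun π hπ s h => Relation.ReflTransGen.tail hπ ⟨s, h, rfl⟩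
  refine ⟨(Combinatorics.finite_isLabelled d).subset hlab, hlab, hcan, hcl, ?_, ?_, ?_, ?_⟩
  · intro π hπ s a ha hmem
    exact mem_neverCritical.1 hmem π hπ s ha
  · intro π hπ
    by_cases hex : ∃ π', Relation.ReflTransGen LabelledStep π₁ π' ∧ ∃ s a, π'.crit s = some a ∧
        π'.coef s a ≠ 0
    · left
      -- From a critical reversing label one reaches types where the only reversing label of the
      -- opposite side is critical, and then the same for the first side. A never critical label has
      -- constant coefficients, so it is reversing on neither side.
      obtain ⟨π', hπ', t, a, ha, hne⟩ := hex
      have hpos := lt_of_le_of_ne ((hlab π' hπ').coef_crit_nonneg ha) (Ne.symm hne)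
      obtain ⟨π₂, hπ₂, c, hc, hcpos, hc'⟩ :=
        exists_unique_opposite_reversing hlab hcan hcl hπ' ha hpos
      obtain ⟨π₃, hπ₃, b, hb, hbpos, hb'⟩ :=
        exists_unique_opposite_reversing hlab hcan hcl hπ₂ hc hcpos
      intro α hα
      have hα' := mem_neverCritical.1 hα
      have hconst : ∀ π'', Relation.ReflTransGen LabelledStep π₁ π'' → ∀ s,
          π''.coef s α = π₁.coef s α := fun π'' hπ'' s =>
        coef_eq_of_labelled_path α hπ'' (fun π₀ hπ₀ s' a' c' _ hc' he =>
          absurd (he ▸ hc') (hα' π₀ hπ₀ s'.opp)) s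
      have h2 : 0 ≤ π₁.coef t α := by
        rw [← hconst π₂ hπ₂]
        by_contra hcon
        rw [hc' α (not_le.1 hcon)] at hα'
        exact hα' π₂ hπ₂ _ hc
      have h3 : π₁.coef t α ≤ 0 := by
        rw [← neg_nonneg, ← Combinatorics.coef_opp, ← hconst π₃ hπ₃]
        by_contra hcon
        rw [hb' α (not_le.1 hcon)] at hα'
        exact hα' π₃ hπ₃ _ hb
      have h4 : π₁.coef t α = 0 := le_antisymm h3 h2
      rw [hconst π hπ]
      rcases Side.eq_or_eq_opp t .top with h | h
      · rw [h, h4]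
      · rw [h, Combinatorics.coef_opp, h4, neg_zero]
    · right
      -- Now winners always have coefficient zero, so all coefficients are constant. A label that is
      -- critical somewhere has coefficient zero there, hence everywhere.
      push Not at hex
      intro α hα
      rw [mem_neverCritical] at hα
      push Not at hα
      obtain ⟨π', hπ', t, ht⟩ := hα
      have hconst : ∀ π'', Relation.ReflTransGen LabelledStep π₁ π'' → ∀ s,
          π''.coef s α = π₁.coef s α := fun π'' hπ'' s =>
        coef_eq_of_labelled_path α hπ'' (fun π₀ hπ₀ s' a' c' ha' _ _ => hex π₀ hπ₀ s' a' ha') s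
      have h4 := hex π' hπ' t α ht
      rw [hconst π' hπ'] at h4
      rw [hconst π hπ]
      rcases Side.eq_or_eq_opp t .top with h | h
      · rw [h, h4]
      · rw [h, Combinatorics.coef_opp, h4, neg_zero]
  · intro α hα π hπ
    rw [mem_neverCritical] at hα
    push Not at hα
    obtain ⟨π', hπ', t, ht⟩ := hα
    exact attainsIn_of_labelled_path ((hback π hπ).trans hπ') ⟨t, ht⟩
  · intro π hπ
    obtain ⟨π', h1, h2⟩ := exists_labelled_path ((h₀ _ (hreach π hπ)).trans hp)
    exact attainsIn_of_labelled_path h1 h2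

/-! ### Avoiding a given sequence of splits is a null event. -/

section Avoidance

/-- The widths whose expansion never begins with the sequence `j` of splits from `p`. -/
def avoiding (p : ReducedType d) (j : List (Side × ReducedType d)) (π : Combinatorics d) :
    Set (Fin d → ℝ) :=
  {x | ∀ n T, (Exchange.mk π x).stage n = some T → ¬BeginsWith T p j}

theorem splitInvariant_avoiding (p : ReducedType d) (j : List (Side × ReducedType d)) :
    SplitInvariant (avoiding p j) := by
  intro π s a c x ha hc hlt hx n T hT
  refine hx (n + 1) T ?_
  rw [Exchange.stage_succ_eq, (Exchange.step_eq_some_iff _ _ _).2 ⟨a, c, ha, hc, hlt, rfl⟩]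
  exact hT

variable {V : Type*} [NormedAddCommGroup V] [NormedSpace ℝ V] [MeasurableSpace V] [BorelSpace V]
  [FiniteDimensional ℝ V] (μ : Measure V) [μ.IsAddHaarMeasure]

open IsRecurrentClass in
/-- From balanced weights, a given sequence of splits is followed with definite probability. -/
theorem improves_of_isSplittingSequence {R : Set (Combinatorics d)} {D : Finset (Fin d)}
    {p : ReducedType d} (hR : IsRecurrentClass R D p) {B : Combinatorics d → Set (Fin d → ℝ)}
    (hB : SplitInvariant B) (j : List (Side × ReducedType d)) {r : ReducedType d}
    (hj : IsSplittingSequence r j) : ∀ C, 1 ≤ C →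
      Improves μ R B (fun π => {x | x ∈ B π ∧ ¬BeginsWith ⟨π, x⟩ r j}) fun π l =>
        ∃ M, (∀ i ∉ D, l i ≤ M) ∧ light D C M l = ∅ ∧ (⟦π⟧ : ReducedType d) = r := by
  induction j generalizing r with
  | nil =>
    intro C _
    refine ⟨1, one_pos, le_rfl, ?_⟩
    rintro u _ _ π _ φ _ l _ ⟨M, -, -, hr⟩
    have h1 : {x | x ∈ B π ∧ ¬BeginsWith ⟨π, x⟩ r []} = ∅ :=
      Set.eq_empty_of_forall_notMem fun x hx => hx.2 hr
    change mass μ φ l {x | x ∈ B π ∧ ¬BeginsWith ⟨π, x⟩ r []} ≤ _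
    rw [h1]
    simp [mass]
  | cons e j ih =>
    obtain ⟨s, q⟩ := e
    obtain ⟨hs, hj⟩ := hj
    intro C hC
    obtain ⟨ε₁, h1, h1', hε₁⟩ := ih hj (2 * C) (by linarith)
    set κ := ((1 + 2 * C)⁻¹) ^ Module.finrank ℝ V with hκ
    have hκ0 : 0 < κ := by positivity
    have hκ1 : κ ≤ 1 := pow_le_one₀ (by positivity) (inv_le_one_of_one_le₀ (by linarith))
    refine ⟨κ * ε₁, by positivity, mul_le_one₀ hκ1 h1.le h1', ?_⟩
    rintro u hu0 hu π hπ φ hφ l hl ⟨M, hM, hlight, rfl⟩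
    obtain ⟨hcan, hq, -⟩ := hs.lift
    obtain ⟨a, c, -, ha, hc, -⟩ := hR.exists_crit hπ s
    have hac := hR.ne_of_crit hπ ha hc
    -- Balanced weights have no light label, so every prescribed loser is heavy; one split at most
    -- doubles the imbalance.
    have hcM : M ≤ C * l c :=
      le_of_notMem_light (hR.crit_notMem π hπ _ _ hc) (by rw [hlight]; simp)
    have h3 := hε₁ u hu0 hu _ (hR.closed π hπ s hcan) _ (hφ.split ha hc hac) _
      (addWeight_pos a c hl) ⟨2 * M, hR.addWeight_le_two_mul hπ ha hc hl hM,
        by rw [light_addWeight (by linarith) hl hcM, hlight], hq⟩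
    refine hR.mass_le_of_split μ hB hu0 hu hπ ha hc hφ hl (fun x hx => hx.1) ?_ h1.le
      (hR.mass_split_ge μ hπ hcan ha hc hφ hl hC hM hcM) h3
    rintro x ⟨hxB, hx⟩ - hlt
    refine ⟨hB π s a c x ha hc hlt hxB, fun hbeg => hx ⟨rfl, _, ?_, hbeg⟩⟩
    exact (Exchange.step_eq_some_iff _ _ _).2 ⟨a, c, ha, hc, hlt, rfl⟩

/-- Above a sink, almost all widths have an expansion in which a given sequence of splits occurs. -/
theorem measure_avoiding_eq_zero {p₀ p : ReducedType d} (h₀ : NonTransient p₀)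
    (hp : Reaches p₀ p) {j : List (Side × ReducedType d)} (hj0 : j ≠ [])
    (hj : IsSplittingSequence p j) {π : Combinatorics d} (hπ : Reaches p₀ ⟦π⟧)
    {φ : V →ₗ[ℝ] (Fin d → ℝ)} (hφ : Parametrizes φ π) :
    μ {y | (∀ i, 0 < φ y i) ∧ φ y ∈ avoiding p j π} = 0 := by
  obtain ⟨s, q, hs⟩ : ∃ s q, Arrow s p q := by
    cases j with
    | nil => exact absurd rfl hj0
    | cons e j => exact ⟨e.1, e.2, hj.1⟩
  have hR := isRecurrentClass_of_nonTransient h₀ hp hs hπ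
  have hB := splitInvariant_avoiding p j
  have hmass : ∀ l : Fin d → ℝ, (∀ i, 0 < l i) → mass μ φ l (avoiding p j π) = 0 := by
    intro l hl
    refine hR.mass_eq_zero μ hB (fun C hC => ?_) Relation.ReflTransGen.refl hφ hl
    obtain ⟨ε, h0, h1, h⟩ := improves_of_isSplittingSequence μ hR hB j hj C hC
    refine ⟨ε, h0, h1, fun u hu0 hu π' hπ' φ' hφ' l' hl' hP => ?_⟩
    refine (mass_mono μ hφ'.injective hl' fun x hx => ?_).trans (h u hu0 hu π' hπ' φ' hφ' l' hl' hP)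
    exact ⟨hx, hx 0 _ rfl⟩
  -- These wedges, given by total width at most `n + 1`, exhaust the positive cone.
  have hnull : ∀ n : ℕ, μ {y | φ y ∈ wedge (fun _ => 1 / ((n : ℝ) + 1)) ∧
      φ y ∈ avoiding p j π} = 0 := by
    intro n
    have hl : ∀ _ : Fin d, 0 < 1 / ((n : ℝ) + 1) := fun _ => by positivity
    have := hmass _ hl
    rw [mass, measureReal_eq_zero_iff (measure_wedge_inter_ne_top μ hφ.injective hl _)] at this
    exact this
  refine measure_mono_null ?_ (measure_iUnion_null hnull)
  rintro y ⟨hy, hya⟩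
  obtain ⟨n, hn⟩ := exists_nat_gt (∑ i, φ y i)
  refine Set.mem_iUnion.2 ⟨n, ⟨hy, ?_⟩, hya⟩
  rw [← Finset.mul_sum, one_div, inv_mul_le_iff₀ (by positivity)]
  linarith

end Avoidance

end NonclassicalIET

namespace NonclassicalIET

variable {d : ℕ}

/-! ### From one occurrence to infinitely many. -/

section Stages

namespace Exchange

/-- Multiply all widths by a factor. -/
def scale (t : ℝ) (T : Exchange d) : Exchange d := ⟨T.comb, t • T.width⟩

theorem step_scale {t : ℝ} (ht : 0 < t) {T T' : Exchange d} {s : Side}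
    (h : T.step = some (s, T')) : (T.scale t).step = some (s, T'.scale t) := by
  obtain ⟨a, c, ha, hc, hlt, rfl⟩ := (step_eq_some_iff _ _ _).1 h
  refine (step_eq_some_iff _ _ _).2 ⟨a, c, ha, hc, mul_lt_mul_of_pos_left hlt ht, ?_⟩
  simp [scale]

theorem stage_scale {t : ℝ} (ht : 0 < t) {n : ℕ} {T T' : Exchange d}
    (h : T.stage n = some T') : (T.scale t).stage n = some (T'.scale t) := by
  induction n generalizing T with
  | zero =>
    cases h
    rfl
  | succ n ih =>
    rw [stage_succ_eq, Option.bind_eq_some_iff] at h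
    obtain ⟨⟨s, T₁⟩, h1, h2⟩ := h
    rw [stage_succ_eq, step_scale ht h1]
    exact ih h2

theorem scale_inv_scale {t : ℝ} (ht : t ≠ 0) (T : Exchange d) : (T.scale t).scale t⁻¹ = T := by
  simp [scale, smul_smul, ht]

/-- Positive widths satisfying the switch condition. -/
def IsPositive (T : Exchange d) : Prop := (∀ i, 0 < T.width i) ∧ T.comb.Switch T.width

theorem IsPositive.step {T T' : Exchange d} {s : Side} (hT : T.IsPositive)
    (h : T.step = some (s, T')) :
    T'.IsPositive ∧ CanSplit T.comb s ∧ T'.comb = T.comb.split s := by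
  obtain ⟨a, c, ha, hc, hlt, rfl⟩ := (step_eq_some_iff _ _ _).1 h
  have hac : a ≠ c := by rintro rfl; exact lt_irrefl _ hlt
  refine ⟨⟨fun i => ?_, ?_⟩, ⟨a, c, T.width, ha, hc, hT.1, hT.2, hlt⟩, rfl⟩
  · simp only [subWidth_apply]
    split_ifs
    · linarith
    · exact hT.1 i
  · rw [Combinatorics.switch_iff _ s]
    simp only [Combinatorics.sw_split T.comb s ha hc hac]
    rw [← Combinatorics.switch_iff]
    exact hT.2

theorem IsPositive.stage {T T' : Exchange d} (hT : T.IsPositive) {n : ℕ}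
    (h : T.stage n = some T') : T'.IsPositive := by
  induction n generalizing T' with
  | zero => cases h; exact hT
  | succ n ih =>
    rw [Exchange.stage, Option.bind_eq_some_iff] at h
    obtain ⟨T₁, h1, h2⟩ := h
    rw [Option.map_eq_some_iff] at h2
    obtain ⟨⟨s, T₂⟩, h2, rfl⟩ := h2
    exact ((ih h1).step h2).1

end Exchange

theorem BeginsWith.scale {t : ℝ} (ht : 0 < t) {T : Exchange d} {p : ReducedType d}
    {j : List (Side × ReducedType d)} (h : BeginsWith T p j) : BeginsWith (T.scale t) p j := by
  induction j generalizing T p with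
  | nil => exact h
  | cons e j ih =>
    obtain ⟨h1, T', h2, h3⟩ := h
    exact ⟨h1, T'.scale t, Exchange.step_scale ht h2, ih h3⟩

theorem smul_mem_avoiding {p : ReducedType d} {j : List (Side × ReducedType d)}
    {π : Combinatorics d} {x : Fin d → ℝ} (hx : x ∈ avoiding p j π) {t : ℝ} (ht : 0 < t) :
    t • x ∈ avoiding p j π := by
  intro n T hT hbeg
  have h1 := Exchange.stage_scale (inv_pos.2 ht) hT
  have h2 : (Exchange.mk π (t • x)).scale t⁻¹ = ⟨π, x⟩ :=
    Exchange.scale_inv_scale ht.ne' ⟨π, x⟩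
  rw [h2] at h1
  exact hx n _ h1 (hbeg.scale (inv_pos.2 ht))

/-- The exchanges above a sink through `p` whose expansion never contains the sequence `j`. -/
def Exceptional (p : ReducedType d) (j : List (Side × ReducedType d)) (T : Exchange d) : Prop :=
  (j ≠ [] ∧ IsSplittingSequence p j ∧
    ∃ p₀, NonTransient p₀ ∧ Reaches p₀ p ∧ Reaches p₀ T.type) ∧ T.width ∈ avoiding p j T.comb

theorem Exceptional.scale {p : ReducedType d} {j : List (Side × ReducedType d)} {T : Exchange d}
    (h : Exceptional p j T) {t : ℝ} (ht : 0 < t) : Exceptional p j (T.scale t) :=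
  ⟨h.1, smul_mem_avoiding h.2 ht⟩

/-- The split at each stage is linear and injective, and the transported parametrization reduces the
later stage to the first, without any assumption that the early stages are recurrent. -/
theorem measure_stage_exceptional_eq_zero {V : Type*} [NormedAddCommGroup V] [NormedSpace ℝ V]
    [MeasurableSpace V] [BorelSpace V] [FiniteDimensional ℝ V] (μ : Measure V) [μ.IsAddHaarMeasure]
    (p : ReducedType d) (j : List (Side × ReducedType d)) (n : ℕ) {π : Combinatorics d}
    {φ : V →ₗ[ℝ] (Fin d → ℝ)} (hφ : Parametrizes φ π) :
    μ {y | (∀ i, 0 < φ y i) ∧ ∃ T, (Exchange.mk π (φ y)).stage n = some T ∧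
      Exceptional p j T} = 0 := by
  induction n generalizing π φ with
  | zero =>
    by_cases h : j ≠ [] ∧ IsSplittingSequence p j ∧
        ∃ p₀, NonTransient p₀ ∧ Reaches p₀ p ∧ Reaches p₀ (⟦π⟧ : ReducedType d)
    · obtain ⟨h1, h2, p₀, h3, h4, h5⟩ := h
      refine measure_mono_null ?_ (measure_avoiding_eq_zero μ h3 h4 h1 h2 h5 hφ)
      rintro y ⟨hy, T, hT, hE⟩
      cases hT
      exact ⟨hy, hE.2⟩
    · refine measure_mono_null (t := ∅) ?_ measure_empty
      rintro y ⟨hy, T, hT, hE⟩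
      cases hT
      exact h hE.1
  | succ n ih =>
    have key : ∀ s, μ {y | (∀ i, 0 < φ y i) ∧ ∃ T', (Exchange.mk π (φ y)).step = some (s, T') ∧
        ∃ T, T'.stage n = some T ∧ Exceptional p j T} = 0 := by
      intro s
      by_cases h : ∃ a c, π.crit s = some a ∧ π.crit s.opp = some c ∧ a ≠ c
      · obtain ⟨a, c, ha, hc, hac⟩ := h
        refine measure_mono_null ?_ (ih (hφ.split ha hc hac))
        rintro y ⟨hy, T', hT', T, hT, hE⟩
        have hpos := Exchange.IsPositive.step ⟨hy, (hφ.mem_range _).1 ⟨y, rfl⟩⟩ hT'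
        obtain ⟨a', c', ha', hc', hlt, rfl⟩ := (Exchange.step_eq_some_iff _ _ _).1 hT'
        simp only [ha, hc, Option.some.injEq] at ha' hc'
        subst ha' hc'
        exact ⟨hpos.1.1, T, hT, hE⟩
      · refine measure_mono_null (t := ∅) ?_ measure_empty
        rintro y ⟨hy, T', hT', -⟩
        obtain ⟨a', c', ha', hc', hlt, -⟩ := (Exchange.step_eq_some_iff _ _ _).1 hT'
        exact h ⟨a', c', ha', hc', by rintro rfl; exact lt_irrefl _ hlt⟩
    refine measure_mono_null ?_ (measure_union_null (key .top) (key .bot))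
    rintro y ⟨hy, T, hT, hE⟩
    rw [Exchange.stage_succ_eq, Option.bind_eq_some_iff] at hT
    obtain ⟨⟨s, T'⟩, h1, h2⟩ := hT
    cases s
    · exact Or.inl ⟨hy, T', h1, T, h2, hE⟩
    · exact Or.inr ⟨hy, T', h1, T, h2, hE⟩

theorem reaches_of_stage {T₀ T : Exchange d} (h₀ : T₀.IsPositive) {n : ℕ}
    (hn : T₀.stage n = some T) {p q : ReducedType d} {s : Side} (hT : NonTransient T.type)
    (hp : Reaches T.type p) (hs : Arrow s p q) (m : ℕ) {T' : Exchange d}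
    (hm : T₀.stage (n + m) = some T') : Reaches T.type T'.type := by
  induction m generalizing T' with
  | zero =>
    rw [add_zero, hn] at hm
    cases hm
    exact .refl
  | succ m ih =>
    rw [← add_assoc, Exchange.stage, Option.bind_eq_some_iff] at hm
    obtain ⟨T₁, h1, h2⟩ := hm
    rw [Option.map_eq_some_iff] at h2
    obtain ⟨⟨t, T₂⟩, h2, rfl⟩ := h2
    obtain ⟨-, h3, h4⟩ := (h₀.stage h1).step h2
    obtain ⟨s', q', h'⟩ := exists_arrow_of_reaches hT hp hs (ih h1)
    obtain ⟨-, -, -, π₀, hπ₀, he⟩ := Arrow.lift (π := T₁.comb) h'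
    refine (ih h1).tail ⟨t, ?_⟩
    have h5 := arrow_of_canSplit h3 hπ₀ he
    rw [← h4] at h5
    exact h5

/-- An expansion which meets a sink without containing a sequence of splits infinitely often has an
exceptional stage. -/
theorem exists_exceptional_stage {T₀ T : Exchange d} (h₀ : T₀.IsPositive) {n : ℕ}
    (hn : T₀.stage n = some T) (hT : NonTransient T.type) {p : ReducedType d}
    {j : List (Side × ReducedType d)} (hp : Reaches T.type p) (hj0 : j ≠ [])
    (hj : IsSplittingSequence p j) (hocc : ¬OccursInfinitelyOften T₀ p j) :
    ∃ m T', T₀.stage m = some T' ∧ Exceptional p j T' := by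
  obtain ⟨s, q, hs⟩ : ∃ s q, Arrow s p q := by
    cases j with
    | nil => exact absurd rfl hj0
    | cons e j => exact ⟨e.1, e.2, hj.1⟩
  have hadd : ∀ m k T₁, T₀.stage m = some T₁ → T₀.stage (m + k) = T₁.stage k := by
    intro m k T₁ hm
    induction k with
    | zero => exact hm
    | succ k ih => rw [← add_assoc, Exchange.stage, ih, Exchange.stage]
  have hexc : ∀ m T₁, T₀.stage (n + m) = some T₁ → T₁.width ∈ avoiding p j T₁.comb →
      ∃ m T', T₀.stage m = some T' ∧ Exceptional p j T' := fun m T₁ hm hav =>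
    ⟨n + m, T₁, hm, ⟨hj0, hj, T.type, hT, hp, reaches_of_stage h₀ hn hT hp hs m hm⟩, hav⟩
  rw [OccursInfinitelyOften, Filter.not_frequently, Filter.eventually_atTop] at hocc
  obtain ⟨N, hN⟩ := hocc
  -- If the expansion survives past the last occurrence, the later stage is exceptional. If it
  -- stops, its last stage is exceptional, since the nonempty sequence cannot begin where no split
  -- is defined.
  by_cases hall : ∃ T₁, T₀.stage (n + N) = some T₁
  · obtain ⟨T₁, hT₁⟩ := hall
    refine hexc N T₁ hT₁ fun k T₂ hk hbeg => hN (n + N + k) (by omega) ⟨T₂, ?_, hbeg⟩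
    rw [hadd _ k T₁ hT₁]
    exact hk
  · classical
    push Not at hall
    have hex : ∃ m, T₀.stage (n + m) = none := ⟨N, Option.eq_none_iff_forall_ne_some.2 hall⟩
    obtain ⟨m, hm⟩ : ∃ m, Nat.find hex = m + 1 := by
      refine Nat.exists_eq_succ_of_ne_zero fun h => ?_
      have := Nat.find_spec hex
      rw [h, add_zero, hn] at this
      cases this
    have h1 : T₀.stage (n + m) ≠ none := Nat.find_min hex (by omega)
    have h2 : T₀.stage (n + (m + 1)) = none := hm ▸ Nat.find_spec hex
    obtain ⟨T₁, hT₁⟩ := Option.ne_none_iff_exists'.1 h1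
    have hstep : T₁.step = none := by
      rw [hadd n (m + 1) T hn] at h2
      rw [hadd n m T hn] at hT₁
      rw [Exchange.stage, hT₁] at h2
      simpa using h2
    refine hexc m T₁ hT₁ fun k T₂ hk hbeg => ?_
    cases k with
    | zero =>
      cases hk
      cases j with
      | nil => exact hj0 rfl
      | cons e j =>
        obtain ⟨-, T', h3, -⟩ := hbeg
        have h4 : T₁.step = some (e.1, T') := h3
        rw [hstep] at h4
        cases h4
    | succ k =>
      have h3 : T₁.stage (k + 1) = some T₂ := hk
      rw [Exchange.stage_succ_eq, hstep] at h3
      cases h3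

end Stages

/-! ### Coordinates on the switch solutions, and transfer to the configuration space. -/

section Chart

/-- The labels other than two given ones. -/
abbrev OtherLabels (a b : Fin d) : Type := {i : Fin d // i ≠ a ∧ i ≠ b}

theorem sum_eq_add_add_sum_otherLabels {a b : Fin d} (hab : a ≠ b) (f : Fin d → ℝ) :
    ∑ i, f i = f a + f b + ∑ i : OtherLabels a b, f i := by
  have h1 : ∑ i ∈ (Finset.univ.erase a).erase b, f i = ∑ i : OtherLabels a b, f i :=
    Finset.sum_subtype _ (fun i => by simp [and_comm]) f
  rw [← h1, ← Finset.add_sum_erase _ f (Finset.mem_univ a),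
    ← Finset.add_sum_erase _ f (Finset.mem_erase.2 ⟨hab.symm, Finset.mem_univ b⟩), add_assoc]

theorem card_otherLabels {a b : Fin d} (hab : a ≠ b) :
    Fintype.card (OtherLabels a b) = d - 2 := by
  rw [Fintype.card_subtype]
  have : (Finset.univ.filter fun i : Fin d => i ≠ a ∧ i ≠ b) = (Finset.univ.erase a).erase b := by
    ext i; simp [and_comm]
  rw [this, Finset.card_erase_of_mem (Finset.mem_erase.2 ⟨hab.symm, Finset.mem_univ b⟩),
    Finset.card_erase_of_mem (Finset.mem_univ a), Finset.card_univ, Fintype.card_fin]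
  omega

/-- The solution of the switch condition with given total width and given widths of the labels other
than a reversing label on each side. -/
noncomputable def chart (π : Combinatorics d) (a b : Fin d) :
    (ℝ × (OtherLabels a b → ℝ)) →ₗ[ℝ] (Fin d → ℝ) where
  toFun y i :=
    -- With switch coefficients `2` and `-2` for `a` and `b`, the total width determines `x_a + x_b`
    -- and the switch condition determines `x_a - x_b`.
    if h : i ≠ a ∧ i ≠ b then y.2 ⟨i, h⟩
    else if i = a then (y.1 - ∑ k, y.2 k - (∑ k, π.coef .top k.1 * y.2 k) / 2) / 2
    else (y.1 - ∑ k, y.2 k + (∑ k, π.coef .top k.1 * y.2 k) / 2) / 2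
  map_add' y y' := by
    ext i
    simp only [Prod.fst_add, Prod.snd_add, Pi.add_apply, mul_add, Finset.sum_add_distrib]
    split_ifs
    · rfl
    · ring
    · ring
  map_smul' t y := by
    ext i
    have e : ∀ k : OtherLabels a b, π.coef .top k.1 * (t * y.2 k) = t * (π.coef .top k.1 * y.2 k) :=
      fun k => by ring
    simp only [Prod.smul_fst, Prod.smul_snd, Pi.smul_apply, smul_eq_mul, e, ← Finset.mul_sum,
      RingHom.id_apply]
    split_ifs
    · rfl
    · ring
    · ring

variable {π : Combinatorics d} {a b : Fin d}

theorem chart_other (y : ℝ × (OtherLabels a b → ℝ)) (i : OtherLabels a b) :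
    chart π a b y i = y.2 i := by
  change (if h : i.1 ≠ a ∧ i.1 ≠ b then y.2 ⟨i.1, h⟩ else _) = _
  rw [dif_pos i.2]

theorem chart_left (y : ℝ × (OtherLabels a b → ℝ)) : chart π a b y a =
    (y.1 - ∑ k, y.2 k - (∑ k, π.coef .top k.1 * y.2 k) / 2) / 2 := by
  change (if h : a ≠ a ∧ a ≠ b then y.2 ⟨a, h⟩ else _) = _
  rw [dif_neg (by simp), if_pos rfl]

theorem chart_right (hab : a ≠ b) (y : ℝ × (OtherLabels a b → ℝ)) : chart π a b y b =
    (y.1 - ∑ k, y.2 k + (∑ k, π.coef .top k.1 * y.2 k) / 2) / 2 := by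
  change (if h : b ≠ a ∧ b ≠ b then y.2 ⟨b, h⟩ else _) = _
  rw [dif_neg (by simp), if_neg hab.symm]

theorem sum_chart (hab : a ≠ b) (y : ℝ × (OtherLabels a b → ℝ)) : ∑ i, chart π a b y i = y.1 := by
  rw [sum_eq_add_add_sum_otherLabels hab, chart_left, chart_right hab]
  simp only [chart_other]
  ring

theorem chart_sum_restrict (hab : a ≠ b) (ha : π.coef .top a = 2) (hb : π.coef .top b = -2)
    {x : Fin d → ℝ} (hx : π.Switch x) : chart π a b (∑ i, x i, fun i => x i) = x := by
  rw [Combinatorics.switch_iff π .top, Combinatorics.sw_eq_sum,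
    sum_eq_add_add_sum_otherLabels hab, ha, hb] at hx
  ext i
  by_cases hi : i ≠ a ∧ i ≠ b
  · exact chart_other _ ⟨i, hi⟩
  · have hs := sum_eq_add_add_sum_otherLabels hab x
    rw [not_and_or, not_not, not_not] at hi
    rcases hi with rfl | rfl
    · rw [chart_left]
      dsimp only
      linarith
    · rw [chart_right hab]
      dsimp only
      linarith

theorem parametrizes_chart (hab : a ≠ b) (ha : π.coef .top a = 2) (hb : π.coef .top b = -2) :
    Parametrizes (chart π a b) π where
  injective y y' h := by
    refine Prod.ext ?_ (funext fun i => ?_)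
    · rw [← sum_chart (π := π) hab y, h, sum_chart hab]
    · rw [← chart_other (π := π) y, h, chart_other]
  mem_range x := by
    constructor
    · rintro ⟨y, rfl⟩
      rw [Combinatorics.switch_iff π .top, Combinatorics.sw_eq_sum,
        sum_eq_add_add_sum_otherLabels hab, ha, hb, chart_left, chart_right hab]
      simp only [chart_other]
      ring
    · exact fun hx => ⟨_, chart_sum_restrict hab ha hb hx⟩

instance : (volume : Measure (ℝ × (OtherLabels a b → ℝ))).IsAddHaarMeasure :=
  Measure.prod.instIsAddHaarMeasure _ _

theorem measure_chart_eq_zero (hab : a ≠ b) (i : Fin d) :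
    (volume : Measure (ℝ × (OtherLabels a b → ℝ))) {y | chart π a b y i = 0} = 0 := by
  let f : (ℝ × (OtherLabels a b → ℝ)) →ₗ[ℝ] ℝ :=
    LinearMap.proj (R := ℝ) (φ := fun _ : Fin d => ℝ) i ∘ₗ chart π a b
  have h1 : {y | chart π a b y i = 0} = (LinearMap.ker f : Set (ℝ × (OtherLabels a b → ℝ))) := by
    ext y; simp [f]
  rw [h1]
  refine Measure.addHaar_submodule _ _ fun htop => ?_
  have hf : ∀ y, chart π a b y i = 0 := fun y => by
    have : y ∈ LinearMap.ker f := by rw [htop]; trivial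
    exact this
  by_cases hi : i ≠ a ∧ i ≠ b
  · have := hf (0, fun _ => 1)
    rw [chart_other _ ⟨i, hi⟩] at this
    simp at this
  · rw [not_and_or, not_not, not_not] at hi
    have := hf (1, 0)
    rcases hi with rfl | rfl
    · rw [chart_left] at this
      simp at this
    · rw [chart_right hab] at this
      simp at this

/-- A conical null set meets the slice of total width one in a null set. -/
theorem volume_slice_eq_zero {A : Set (Fin d → ℝ)}
    (hA : ∀ x ∈ A, ∀ t : ℝ, 0 < t → t • x ∈ A)
    (h : (volume : Measure (ℝ × (OtherLabels a b → ℝ))) {y | chart π a b y ∈ A} = 0) :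
    (volume : Measure (OtherLabels a b → ℝ)) {z | chart π a b (1, z) ∈ A} = 0 := by
  have h1 : ∀ᵐ y ∂((volume : Measure ℝ).prod (volume : Measure (OtherLabels a b → ℝ))),
      chart π a b y ∉ A := by
    rw [ae_iff, ← Measure.volume_eq_prod]
    simpa using h
  have h2 := Measure.ae_ae_of_ae_prod h1
  -- By Fubini almost every slice is null, so some slice of positive total width is; rescaling moves
  -- it to total width one.
  have h3 : ∃ r : ℝ, 0 < r ∧ ∀ᵐ z : OtherLabels a b → ℝ, chart π a b (r, z) ∉ A := by
    by_contra! hcon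
    have h4 : (volume : Measure ℝ) (Set.Ioi 0) = 0 :=
      measure_mono_null (fun r hr => hcon r hr) (ae_iff.1 h2)
    simp at h4
  obtain ⟨r, hr, h4⟩ := h3
  have h5 : {z | chart π a b (1, z) ∈ A} ⊆
      (fun z : OtherLabels a b → ℝ => r • z) ⁻¹' {z | chart π a b (r, z) ∈ A} := by
    intro z hz
    have h6 := hA _ hz r hr
    rw [← map_smul] at h6
    simpa using h6
  refine measure_mono_null h5 ?_
  rw [Measure.addHaar_preimage_smul _ hr.ne']
  have h7 : volume {z | chart π a b (r, z) ∈ A} = 0 := by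
    rw [ae_iff] at h4
    simpa using h4
  rw [h7, mul_zero]

theorem hausdorff_slice_eq_zero (hab : a ≠ b) {A : Set (Fin d → ℝ)}
    (h : (volume : Measure (OtherLabels a b → ℝ)) {z | chart π a b (1, z) ∈ A} = 0) :
    (μHE[d - 2] : Measure (EuclideanSpace ℝ (Fin d)))
      ((fun z => WithLp.toLp 2 (chart π a b (1, z))) '' {z | chart π a b (1, z) ∈ A}) = 0 := by
  let L : (OtherLabels a b → ℝ) →ₗ[ℝ] EuclideanSpace ℝ (Fin d) :=
    (WithLp.linearEquiv 2 ℝ (Fin d → ℝ)).symm.toLinearMap ∘ₗ chart π a b ∘ₗ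
      LinearMap.inr ℝ ℝ (OtherLabels a b → ℝ)
  have hψ : (fun z => WithLp.toLp 2 (chart π a b (1, z))) =
      fun z => L.toContinuousLinearMap z + WithLp.toLp 2 (chart π a b (1, 0)) := by
    funext z
    have h1 : ((1, z) : ℝ × (OtherLabels a b → ℝ)) = (0, z) + (1, 0) := by simp
    rw [h1, map_add]
    rfl
  have hlip : LipschitzWith ‖L.toContinuousLinearMap‖₊
      fun z => WithLp.toLp 2 (chart π a b (1, z)) := by
    rw [hψ]
    have := L.toContinuousLinearMap.lipschitz.add
      (LipschitzWith.const (WithLp.toLp 2 (chart π a b (1, 0))))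
    simpa using this
  rw [Measure.euclideanHausdorffMeasure_def, Measure.smul_apply]
  -- The slice is a Lipschitz image of a space of dimension `d - 2`, on which Hausdorff measure is
  -- Lebesgue measure.
  have h2 := hlip.hausdorffMeasure_image_le (d := ((d - 2 : ℕ) : ℝ)) (by positivity)
    {z | chart π a b (1, z) ∈ A}
  have h3 : (μH[((d - 2 : ℕ) : ℝ)] : Measure (OtherLabels a b → ℝ)) = volume := by
    rw [← card_otherLabels hab]
    exact hausdorffMeasure_pi_real
  rw [h3, h, mul_zero, nonpos_iff_eq_zero] at h2
  rw [h2, smul_zero]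

end Chart

theorem Combinatorics.measurableSet_configurationSpace (π : Combinatorics d) :
    MeasurableSet π.configurationSpace := by
  have hc : ∀ i, Measurable fun x : EuclideanSpace ℝ (Fin d) => x i := fun i =>
    (EuclideanSpace.proj (𝕜 := ℝ) i).continuous.measurable
  have h : π.configurationSpace = (⋂ i, {x | 0 ≤ x i}) ∩ ({x | ∑ i, x i = 1} ∩
      {x | ∑ i, π.coef .top i * x i = 0}) := by
    ext x
    simp [configurationSpace, Combinatorics.switch_iff π .top, Combinatorics.sw_eq_sum]
  rw [h]
  refine (MeasurableSet.iInter fun i => measurableSet_le measurable_const (hc i)).inter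
    ((measurableSet_eq_fun (Finset.measurable_sum _ fun i _ => hc i) measurable_const).inter
      (measurableSet_eq_fun (Finset.measurable_sum _ fun i _ => (hc i).const_mul _)
        measurable_const))

/-- Countability of the vertices and of the sequences of splits lets one null set serve all of them
at once. -/
instance : Countable (Combinatorics d) :=
  Function.Injective.countable (f := fun π : Combinatorics d => (π.top, π.bot))
    fun _ _ h => Combinatorics.ext (congrArg Prod.fst h) (congrArg Prod.snd h)

instance : Countable Side :=
  Function.Injective.countable (f := fun s : Side => match s with | .top => true | .bot => false)
    fun s t h => by cases s <;> cases t <;> simp_all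

end NonclassicalIET

open NonclassicalIET in
/-- Normality. For almost every point `x` of the configuration space: whenever the expansion of `x` is
at a vertex of a sink, every finite (nonempty) splitting sequence in this sink occurs infinitely often
in the expansion. When the starting type `π` itself lies in a sink, this applies with `n = 0`. -/
theorem theorem1p1 {d : ℕ} (π : Combinatorics d) (hπ : π.IsNonclassical) :
    ∀ᵐ x : EuclideanSpace ℝ (Fin d) ∂π.lebesgue,
      ∀ (n : ℕ) (T : Exchange d), (Exchange.mk π fun α => x α).stage n = some T →
        NonTransient T.type →
          ∀ (p : ReducedType d) (j : List (Side × ReducedType d)),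
            Reaches T.type p → j ≠ [] → IsSplittingSequence p j →
              OccursInfinitelyOften (Exchange.mk π fun α => x α) p j := by
  obtain ⟨a, ha⟩ := hπ.reversing .top
  obtain ⟨b, hb⟩ := hπ.reversing .bot
  have hla := hπ.labelled a
  have hlb := hπ.labelled b
  change π.top.count a = 2 at ha
  change π.bot.count b = 2 at hb
  have ha' : π.coef .top a = 2 := by
    have h1 : π.bot.count a = 0 := by omega
    simp [Combinatorics.coef, Combinatorics.word, Side.opp, ha, h1]
  have hb' : π.coef .top b = -2 := by
    have h1 : π.top.count b = 0 := by omega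
    simp [Combinatorics.coef, Combinatorics.word, Side.opp, hb, h1]
  have hab : a ≠ b := by
    rintro rfl
    linarith
  have hφ := parametrizes_chart hab ha' hb'
  -- The bad set is made conical, for the passage to a slice, and contains the boundary faces, where
  -- the estimates for positive widths do not apply.
  set A : Set (Fin d → ℝ) := {x | (∀ i, 0 ≤ x i) ∧ ((∃ i, x i = 0) ∨
    (∀ i, 0 < x i) ∧ ∃ (p : ReducedType d) (j : List (Side × ReducedType d)) (m : ℕ),
      ∃ T, (Exchange.mk π x).stage m = some T ∧ Exceptional p j T)} with hA
  have hcone : ∀ x ∈ A, ∀ t : ℝ, 0 < t → t • x ∈ A := by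
    rintro x ⟨h0, h1⟩ t ht
    refine ⟨fun i => mul_nonneg ht.le (h0 i), ?_⟩
    rcases h1 with ⟨i, hi⟩ | ⟨hpos, p, j, m, T, hT, hE⟩
    · exact Or.inl ⟨i, by simp [hi]⟩
    · exact Or.inr ⟨fun i => mul_pos ht (hpos i), p, j, m, T.scale t,
        Exchange.stage_scale ht hT, hE.scale ht⟩
  have hnull : (volume : Measure (ℝ × (OtherLabels a b → ℝ))) {y | chart π a b y ∈ A} = 0 := by
    refine measure_mono_null ?_ (measure_union_null
      (measure_iUnion_null fun i => measure_chart_eq_zero (π := π) hab i)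
      (measure_iUnion_null fun p : ReducedType d =>
        measure_iUnion_null fun j : List (Side × ReducedType d) =>
          measure_iUnion_null fun m : ℕ => measure_stage_exceptional_eq_zero volume p j m hφ))
    rintro y ⟨-, ⟨i, hi⟩ | ⟨hpos, p, j, m, hT⟩⟩
    · exact Or.inl (Set.mem_iUnion.2 ⟨i, hi⟩)
    · exact Or.inr (Set.mem_iUnion.2 ⟨p, Set.mem_iUnion.2 ⟨j, Set.mem_iUnion.2 ⟨m, hpos, hT⟩⟩⟩)
  have hslice := hausdorff_slice_eq_zero hab (volume_slice_eq_zero hcone hnull)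
  rw [Combinatorics.lebesgue]
  -- The normalizing factor plays no role for null sets.
  refine Measure.ae_smul_measure ?_ _
  rw [ae_restrict_iff' π.measurableSet_configurationSpace, ae_iff]
  refine measure_mono_null ?_ hslice
  intro x hx
  simp only [Set.mem_ofPred_eq, Classical.not_imp] at hx
  obtain ⟨⟨hx0, hx1, hsw⟩, hx⟩ := hx
  have hchart : chart π a b (1, fun i => x i) = fun i => x i := by
    have := chart_sum_restrict hab ha' hb' hsw
    rwa [hx1] at this
  refine ⟨fun i => x i, ?_, ?_⟩
  · change chart π a b (1, fun i => x i) ∈ A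
    rw [hchart]
    refine ⟨hx0, ?_⟩
    by_cases hzero : ∃ i, x i = 0
    · exact Or.inl hzero
    · push Not at hzero
      have hpos : ∀ i, 0 < x i := fun i => lt_of_le_of_ne (hx0 i) (Ne.symm (hzero i))
      push Not at hx
      obtain ⟨n, T, hT, hnt, p, j, hp, hj0, hj, hocc⟩ := hx
      obtain ⟨m, T', h1, h2⟩ := exists_exceptional_stage ⟨hpos, hsw⟩ hT hnt hp hj0 hj hocc
      exact Or.inr ⟨hpos, p, j, m, T', h1, h2⟩
  · change WithLp.toLp 2 (chart π a b (1, fun i => x i)) = x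
    rw [hchart]
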